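/- Let $(\Omega,\mathcal F,\mathrm P)$ be a probability space with a filtration $(\mathcal F_t)_{t\ge 0}$, and let $M\ge 2$ (investors) and $N\ge 1$ (assets). Let the payoffs $X_t=(X_t^1,\dots,X_t^N)\in\mathbb R_+^N$, $t\ge1$, be $\mathcal F_t$-measurable and the gross returns of the bank account $\rho_t\ge 0$, $t\ge 1$, be $\mathcal F_{t-1}$-measurable, with $\rho_t+\sum_n X_t^n>0$ a.s. for all $t\ge1$. Let $\Delta=\{\lambda\in\mathbb R_+^{MN}:\sum_n\lambda^{m,n}\le 1\text{ for each }m\}$. A strategy of an investor is a sequence of $\mathcal F_{t-1}\otimes\mathcal B(\mathbb R_+^M\times\Delta^{t-1})$-measurable functions $\Lambda_t(\omega,y_0,\lambda_1,\dots,\lambda_{t-1})$, $t\ge1$, with values in $\{a\in\mathbb R_+^N:\sum_n a^n\le1\}$. Given initial capitals $Y_0\in\mathbb R_+^M$ with $Y_0^k>0$ for all $k$ and a profile $L=(\Lambda^1,\dots,\Lambda^M)$ of strategies, the realizations are $\lambda_t^{m}(\omega)=\Lambda_t^{m}(\omega,Y_0,\lambda_1(\omega),\dots,\lambda_{t-1}(\omega))$,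 where $\lambda_s=(\lambda_s^{m,n})_{m,n}$, and the wealth of investor $m$ is given by \[ Y_t^m=\rho_t\Bigl(1-\sum_n\lambda_t^{m,n}\Bigr)Y_{t-1}^m+\sum_n\frac{\lambda_t^{m,n}Y_{t-1}^m}{\sum_k\lambda_t^{k,n}Y_{t-1}^k}X_t^n,\qquad t\ge1\quad(0/0=0). \] The relative wealth is $r_t^m=Y_t^m/\sum_kY_t^k$ (with $0/0=0$). A strategy $\Lambda^m$ of investor $m$ is relative growth optimal if, for all initial capitals $Y_0$ with $Y_0^k>0$ for all $k$ and all strategies of the other investors, $\ln r_t^m$ is a submartingale (in particular it is a.s. finite and integrable). Let $K_t(\omega,dx)$ be a regular conditional distribution on $\mathbb R_+^N$ of $X_t$ given $\mathcal F_{t-1}$, and $|x|=\sum_n x^n$ for $x\in\mathbb R^N_+$. For $c\ge 0$ let $\zeta_t(\omega,c)$ be the unique root $z\in(0,c]$ of \[ \int_{\mathbb R_+^N}\frac{c\rho_t(\omega)}{z\rho_t(\omega)+|x|}K_t(\omega,dx)=1 \] if $\int_{\mathbb R_+^N} \frac{c\rho_t(\omega)}{|x|}K_t(\omega,dx)>1$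 (with $0/0=0$ and $a/0=+\infty$ for $a>0$), and let $\zeta_t(\omega,c)=0$ otherwise. For a history $\chi_{t-1}=(y_0,\lambda_1,\dots,\lambda_{t-1})$ let $C_{t-1}(\omega,\chi_{t-1})$ be the total wealth at time $t-1$ that the wealth equation yields from the initial capitals $y_0$ and the proportions $\lambda_1,\dots,\lambda_{t-1}$. Define (with $0/0=0$) \[ \hat\Lambda_t^n(\omega,\chi_{t-1})=\int_{\mathbb R_+^N}\frac{x^n}{\zeta_t(\omega,C_{t-1}(\omega,\chi_{t-1}))\rho_t(\omega)+|x|}K_t(\omega,dx). \] Then, for every investor $m$: (1) $\hat\Lambda$ is a strategy, and it is relative growth optimal for investor $m$. (2) Suppose that $\Lambda$ is a strategy of investor $m$ such that, when she uses it, $r_t^m$ is a submartingale for all strictly positive initial capitals and all strategies of the other investors. Then $\hat\Lambda$ and $\Lambda$ are equal in realization until $\tau=\inf\{t\ge0:r_t^m=1\}$ (with $\inf\emptyset=\infty$). That is, for all strictly positive initial capitals $Y_0$ and all strategies of the other investors, if $\hat L$ and $L$ denote the profiles in which investor $m$ uses $\hat\Lambda$ and $\Lambda$, respectively, then almost surely,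 for all $t\ge1$ with $t\le\tau(\omega;Y_0,\hat L)\wedge\tau(\omega;Y_0,L)$, the realizations of the strategy of investor $m$ at time $t$ in the two markets coincide: $\lambda_t^m(\omega;Y_0,\hat L)=\lambda_t^m(\omega;Y_0,L)$. -/

import Mathlib

open MeasureTheory ProbabilityTheory
open scoped NNReal ENNReal

namespace AssetMarketGame

/-- Vectors of investment proportions of one investor: `a n` is the share of the budget put into
asset `n`; the remaining share `1 - ∑ n, a n ≥ 0` goes to the bank account. -/
def Action (N : ℕ) : Type := {a : Fin N → ℝ≥0 // ∑ n, a n ≤ 1}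

instance (N : ℕ) : MeasurableSpace (Action N) :=
  inferInstanceAs (MeasurableSpace {a : Fin N → ℝ≥0 // ∑ n, a n ≤ 1})

/-- The `ℓ¹`-norm of a vector with nonnegative coordinates. -/
def l1 {N : ℕ} (x : Fin N → ℝ≥0) : ℝ≥0 := ∑ n, x n

/-- The history `(λ₁, …, λₜ)` of the proportions chosen by all `M` investors up to time `t`;
`λ_{s+1}` is the entry with index `s`. -/
abbrev Actions (M N t : ℕ) : Type := Fin t → Fin M → Action N

/-- A sequence of functions `(ω, y₀, λ₁, …, λₜ) ↦ Λ_{t+1}(ω, y₀, λ₁, …, λₜ)`, `t = 0, 1, …`;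
so `Λ t` is the decision about the proportions `λ_{t+1}`, taken at time `t`. -/
abbrev Rule (Ω : Type*) (M N : ℕ) : Type _ :=
  (t : ℕ) → Ω → (Fin M → ℝ≥0) → Actions M N t → Action N

/-- A rule is a strategy if `Λ_{t+1}` is jointly measurable, `ω` being taken with the
σ-algebra `ℱ t`. -/
def IsStrategy {Ω : Type*} {m0 : MeasurableSpace Ω} {M N : ℕ} (ℱ : Filtration ℕ m0)
    (Λ : Rule Ω M N) : Prop :=
  ∀ t : ℕ, Measurable[(ℱ t).prod inferInstance]
    (fun p : Ω × ((Fin M → ℝ≥0) × Actions M N t) => Λ t p.1 p.2.1 p.2.2)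

/-- One step of the wealth equation: from wealth vector `y`, proportions `a`, gross return `ρ`
of the bank account and payoffs `x`. The subtraction is a true one, as `∑ n, (a m).1 n ≤ 1`,
and division is with `0 / 0 = 0`. -/
noncomputable def wealthStep {M N : ℕ} (ρ : ℝ≥0) (x : Fin N → ℝ≥0) (a : Fin M → Action N)
    (y : Fin M → ℝ≥0) (m : Fin M) : ℝ≥0 :=
  ρ * (1 - ∑ n, (a m).1 n) * y m
    + ∑ n, ((a m).1 n * y m) / (∑ k, (a k).1 n * y k) * x n

section Model

variable {Ω : Type*} {M N : ℕ} (X : ℕ → Ω → Fin N → ℝ≥0) (ρ : ℕ → Ω → ℝ≥0)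

/-- The wealth vector at time `t` as a function of `ω` and of the history. -/
noncomputable def wealthOf (ω : Ω) (y₀ : Fin M → ℝ≥0) :
    (t : ℕ) → Actions M N t → Fin M → ℝ≥0
  | 0, _ => y₀
  | t + 1, h =>
      wealthStep (ρ (t + 1) ω) (X (t + 1) ω) (h (Fin.last t)) (wealthOf ω y₀ t (Fin.init h))

/-- Total wealth `C_t(ω, y₀, λ₁, …, λₜ)` of all investors as a function of `ω` and of the
history. -/
noncomputable def totalWealthOf (ω : Ω) (y₀ : Fin M → ℝ≥0) (t : ℕ) (h : Actions M N t) : ℝ≥0 :=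
  ∑ m, wealthOf X ρ ω y₀ t h m

/-- The history `(λ₁(ω), …, λₜ(ω))` produced by the strategy profile `L` from the initial
capitals `y₀`. -/
def history (L : Fin M → Rule Ω M N) (y₀ : Fin M → ℝ≥0) (ω : Ω) : (t : ℕ) → Actions M N t
  | 0 => Fin.elim0
  | t + 1 => Fin.snoc (history L y₀ ω t) (fun m => L m t ω y₀ (history L y₀ ω t))

/-- The realization `λ_{t+1}^m(ω; y₀, L)` of the strategy of investor `m`. -/
def realization (L : Fin M → Rule Ω M N) (y₀ : Fin M → ℝ≥0) (m : Fin M) (t : ℕ) (ω : Ω) :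
    Action N :=
  L m t ω y₀ (history L y₀ ω t)

/-- The wealth `Y_t^m(ω)`. -/
noncomputable def wealth (L : Fin M → Rule Ω M N) (y₀ : Fin M → ℝ≥0) (m : Fin M) (t : ℕ)
    (ω : Ω) : ℝ≥0 :=
  wealthOf X ρ ω y₀ t (history L y₀ ω t) m

/-- The relative wealth `r_t^m(ω) = Y_t^m / ∑ k, Y_t^k`, with `0 / 0 = 0`. -/
noncomputable def relWealth (L : Fin M → Rule Ω M N) (y₀ : Fin M → ℝ≥0) (m : Fin M) (t : ℕ)
    (ω : Ω) : ℝ :=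
  (wealth X ρ L y₀ m t ω : ℝ) / ∑ k, (wealth X ρ L y₀ k t ω : ℝ)

/-- The first time `inf {t ≥ 0 : r_t^m = 1}`, which is `⊤` if there is no such `t`. -/
noncomputable def hitOne (m : Fin M) (y₀ : Fin M → ℝ≥0) (L : Fin M → Rule Ω M N) (ω : Ω) : ℕ∞ :=
  ⨅ (t : ℕ) (_ : relWealth X ρ L y₀ m t ω = 1), (t : ℕ∞)

variable {m0 : MeasurableSpace Ω} (μ : Measure Ω) (ℱ : Filtration ℕ m0)

/-- `ln r_t^m` is a submartingale for all positive initial capitals and all strategies of the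
others, when investor `m` uses `Λ`. As `Real.log 0 = 0`, the requirement that `ln r_t^m` be
a.s. finite is stated explicitly. -/
def IsRelativeGrowthOptimal (m : Fin M) (Λ : Rule Ω M N) : Prop :=
  ∀ y₀ : Fin M → ℝ≥0, (∀ k, 0 < y₀ k) →
    ∀ L : Fin M → Rule Ω M N, (∀ k, k ≠ m → IsStrategy ℱ (L k)) →
      (∀ t, ∀ᵐ ω ∂μ, 0 < relWealth X ρ (Function.update L m Λ) y₀ m t ω) ∧
      Submartingale
        (fun t ω => Real.log (relWealth X ρ (Function.update L m Λ) y₀ m t ω)) ℱ μ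

/-- `r_t^m` is a submartingale for all positive initial capitals and all strategies of the
others, when investor `m` uses `Λ`. -/
def RelWealthSubmartingale (m : Fin M) (Λ : Rule Ω M N) : Prop :=
  ∀ y₀ : Fin M → ℝ≥0, (∀ k, 0 < y₀ k) →
    ∀ L : Fin M → Rule Ω M N, (∀ k, k ≠ m → IsStrategy ℱ (L k)) →
      Submartingale (relWealth X ρ (Function.update L m Λ) y₀ m) ℱ μ

/-- Strategies `Λ`, `Λ'` of investor `m` are equal in realization until `τ`: whatever the initial
capitals and the strategies of the others are, a.s. for every `t ≥ 0`, the realizations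
`λ_{t+1}^m` agree if `t + 1` does not exceed `τ` in either of the two markets. -/
def EqualInRealizationUntil (m : Fin M) (Λ Λ' : Rule Ω M N)
    (τ : (Fin M → ℝ≥0) → (Fin M → Rule Ω M N) → Ω → ℕ∞) : Prop :=
  ∀ y₀ : Fin M → ℝ≥0, (∀ k, 0 < y₀ k) →
    ∀ L : Fin M → Rule Ω M N, (∀ k, k ≠ m → IsStrategy ℱ (L k)) →
      ∀ᵐ ω ∂μ, ∀ t : ℕ,
        ((t + 1 : ℕ) : ℕ∞) ≤
            min (τ y₀ (Function.update L m Λ) ω) (τ y₀ (Function.update L m Λ') ω) →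
          realization (Function.update L m Λ) y₀ m t ω
            = realization (Function.update L m Λ') y₀ m t ω

/-- `K t` is a regular conditional distribution of the payoff vector `X_{t+1}` given `ℱ t`
(measurability in `ω` with respect to `ℱ t` is part of the type of `K t`). -/
def IsRegularCondDistrib (K : (t : ℕ) → @Kernel Ω (Fin N → ℝ≥0) (ℱ t) _) : Prop :=
  ∀ (t : ℕ) (A : Set (Fin N → ℝ≥0)), MeasurableSet A →
    (fun ω => (K t ω).real A) =ᵐ[μ] μ⟦X (t + 1) ⁻¹' A | ℱ t⟧

/-- Regular conditional distributions of the payoffs exist, for every filtration. -/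
theorem exists_regularCondDistrib [IsProbabilityMeasure μ]
    (hX : ∀ t : ℕ, Measurable[ℱ (t + 1)] (X (t + 1))) :
    ∃ K : (t : ℕ) → @Kernel Ω (Fin N → ℝ≥0) (ℱ t) _,
      (∀ t, IsMarkovKernel (K t)) ∧ IsRegularCondDistrib X μ ℱ K := by
  refine ⟨fun t => @condDistrib Ω Ω (Fin N → ℝ≥0) _ _ _ m0 (ℱ t) (X (t + 1)) id μ _,
    fun t => inferInstance, ?_⟩
  intro t A hA
  have := condDistrib_ae_eq_condExp (mβ := ℱ t) (X := id) (Y := X (t + 1)) (μ := μ)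
     (measurable_id'' (ℱ.le t)) ((hX t).mono (ℱ.le _) le_rfl) hA
  rw [MeasurableSpace.comap_id] at this
  exact this

end Model

section Root

variable {N : ℕ} (κ : Measure (Fin N → ℝ≥0)) [IsProbabilityMeasure κ] (ρ c : ℝ≥0)

/-- The section of the set `Γ_t`, i.e. `∫ c ρ / |x| κ(dx) > 1`. Division in `ℝ≥0∞` has
`0 / 0 = 0` and `a / 0 = ∞` for `a > 0`. -/
def InGamma : Prop :=
  1 < ∫⁻ x : Fin N → ℝ≥0, ((c * ρ : ℝ≥0) : ℝ≥0∞) / (l1 x : ℝ≥0∞) ∂κ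

/-- `z ∈ (0, c]` solves `∫ c ρ / (z ρ + |x|) κ(dx) = 1`. -/
def IsRoot (z : ℝ≥0) : Prop :=
  0 < z ∧ z ≤ c ∧
    ∫⁻ x : Fin N → ℝ≥0, ((c * ρ : ℝ≥0) : ℝ≥0∞) / ((z * ρ + l1 x : ℝ≥0) : ℝ≥0∞) ∂κ = 1

theorem measurable_l1 : Measurable (l1 : (Fin N → ℝ≥0) → ℝ≥0) := by
  unfold l1; fun_prop

theorem existsUnique_root (h : InGamma κ ρ c) : ∃! z, IsRoot κ ρ c z := by
  have hml : Measurable (l1 : (Fin N → ℝ≥0) → ℝ≥0) := measurable_l1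
  set g : ℝ≥0 → (Fin N → ℝ≥0) → ℝ≥0∞ := fun z x =>
    ((c * ρ : ℝ≥0) : ℝ≥0∞) / ((z * ρ + l1 x : ℝ≥0) : ℝ≥0∞) with hg
  have hgm : ∀ z, Measurable (g z) := fun z => by
    simp only [hg]; fun_prop
  have hcρ : 0 < c * ρ := by
    by_contra h0
    have h0' : c * ρ = 0 := le_antisymm (not_lt.mp h0) zero_le
    simp [InGamma, h0'] at h
  have hρ : 0 < ρ := pos_of_mul_pos_right hcρ zero_le
  have hc : 0 < c := pos_of_mul_pos_left hcρ zero_le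
  have hanti : ∀ z z' x, z ≤ z' → g z' x ≤ g z x := fun z z' x hz => by
    simp only [hg]; gcongr
  have hcont : ∀ x, Continuous (fun z => g z x) := fun x => by
    simp only [hg, div_eq_mul_inv]
    refine ENNReal.continuous_const_mul ENNReal.coe_ne_top |>.comp ?_
    refine continuous_inv.comp ?_
    exact ENNReal.continuous_coe.comp (by fun_prop)
  have h0 : 1 < ∫⁻ x, g 0 x ∂κ := by simpa [InGamma, hg] using h
  have hbound : ∀ z x, 0 < z → g z x ≤ ((c * ρ : ℝ≥0) : ℝ≥0∞) / ((z * ρ : ℝ≥0) : ℝ≥0∞) := by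
    intro z x hz
    simp only [hg]
    gcongr
    exact le_self_add
  have hfin : ∀ z, 0 < z → ((c * ρ : ℝ≥0) : ℝ≥0∞) / ((z * ρ : ℝ≥0) : ℝ≥0∞) ≠ ∞ := by
    intro z hz
    exact ENNReal.div_ne_top ENNReal.coe_ne_top (by exact_mod_cast (mul_pos hz hρ).ne')
  have hcle : ∫⁻ x, g c x ∂κ ≤ 1 := by
    calc ∫⁻ x, g c x ∂κ ≤ ∫⁻ _, 1 ∂κ := by
          refine lintegral_mono fun x => ?_
          refine (hbound c x hc).trans ?_
          rw [ENNReal.div_self] <;> simp [hc.ne', hρ.ne', ENNReal.mul_eq_top]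
      _ = 1 := by simp
  obtain ⟨z₀, hz₀, hz₀1⟩ : ∃ z₀ : ℝ≥0, 0 < z₀ ∧ 1 < ∫⁻ x, g z₀ x ∂κ := by
    have ht : Filter.Tendsto (fun k : ℕ => ∫⁻ x, g (1 / ((k : ℝ≥0) + 1)) x ∂κ) Filter.atTop
        (nhds (∫⁻ x, g 0 x ∂κ)) := by
      refine lintegral_tendsto_of_tendsto_of_monotone (fun k => (hgm _).aemeasurable) ?_ ?_
      · refine Filter.Eventually.of_forall fun x k k' hk => hanti _ _ x ?_
        gcongr
      · refine Filter.Eventually.of_forall fun x => ?_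
        exact ((hcont x).tendsto 0).comp tendsto_one_div_add_atTop_nhds_zero_nat
    obtain ⟨k, hk⟩ := (ht.eventually_const_lt h0).exists
    exact ⟨_, by positivity, hk⟩
  have hz₀c : z₀ ≤ c := by
    by_contra hlt
    have := lintegral_mono (μ := κ) (fun x => hanti c z₀ x (not_le.mp hlt).le)
    exact absurd (hz₀1.trans_le (this.trans hcle)) (lt_irrefl _)
  have hcontI : ContinuousOn (fun z => ∫⁻ x, g z x ∂κ) (Set.Icc z₀ c) := by
    intro z _
    refine tendsto_lintegral_filter_of_dominated_convergence
      (fun _ => ((c * ρ : ℝ≥0) : ℝ≥0∞) / ((z₀ * ρ : ℝ≥0) : ℝ≥0∞)) ?_ ?_ ?_ ?_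
    · exact Filter.Eventually.of_forall fun z => (hgm z)
    · filter_upwards [self_mem_nhdsWithin] with z' hz'
      exact Filter.Eventually.of_forall fun x => (hanti _ _ x hz'.1).trans (hbound z₀ x hz₀)
    · simpa using hfin z₀ hz₀
    · exact Filter.Eventually.of_forall fun x => ((hcont x).tendsto z).mono_left nhdsWithin_le_nhds
  obtain ⟨z, hz, hz1⟩ := intermediate_value_Icc' hz₀c hcontI ⟨hcle, hz₀1.le⟩
  have hstrict : ∀ a b : ℝ≥0, 0 < a → a < b → ∫⁻ x, g b x ∂κ = 1 → ∫⁻ x, g a x ∂κ = 1 → False := by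
    intro a b ha hab hb1 ha1
    have := lintegral_strict_mono (μ := κ) (f := g b) (g := g a) (IsProbabilityMeasure.ne_zero κ)
      (hgm a).aemeasurable (by simp [hb1]) (Filter.Eventually.of_forall fun x => by
        simp only [hg]
        refine ENNReal.div_lt_div_left (by exact_mod_cast hcρ.ne') ENNReal.coe_ne_top ?_
        exact_mod_cast add_lt_add_left (mul_lt_mul_of_pos_right hab hρ) _)
    simp [ha1, hb1] at this
  refine ⟨z, ⟨hz₀.trans_le hz.1, hz.2, hz1⟩, fun w hw => ?_⟩
  rcases lt_trichotomy w z with hlt | heq | hlt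
  · exact (hstrict w z hw.1 hlt hz1 hw.2.2).elim
  · exact heq
  · exact (hstrict z w (hz₀.trans_le hz.1) hlt hw.2.2 hz1).elim

open Classical in
/-- `ζ`: the unique root on `Γ_t`, and `0` outside. -/
noncomputable def zeta : ℝ≥0 :=
  if h : InGamma κ ρ c then (existsUnique_root κ ρ c h).choose else 0

/-- `∫ xⁿ / (ζ ρ + |x|) κ(dx)`, with `0 / 0 = 0`; the integrand is at most `1`. -/
noncomputable def optimalShare (n : Fin N) : ℝ≥0 :=
  (∫⁻ x : Fin N → ℝ≥0, ((x n / (zeta κ ρ c * ρ + l1 x) : ℝ≥0) : ℝ≥0∞) ∂κ).toNNReal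

theorem sum_optimalShare_le : ∑ n, optimalShare κ ρ c n ≤ 1 := by
  have hml : Measurable (l1 : (Fin N → ℝ≥0) → ℝ≥0) := measurable_l1
  have hsum : ∑ n, ∫⁻ x : Fin N → ℝ≥0, ((x n / (zeta κ ρ c * ρ + l1 x) : ℝ≥0) : ℝ≥0∞) ∂κ ≤ 1 := by
    rw [← lintegral_finsetSum' _ (fun n _ => by fun_prop)]
    calc _ ≤ ∫⁻ _, 1 ∂κ := by
          refine lintegral_mono fun x => ?_
          rw [← ENNReal.ofNNReal_finsetSum]
          have : ∑ n, x n / (zeta κ ρ c * ρ + l1 x) ≤ 1 := by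
            rw [← Finset.sum_div]
            exact div_le_one_of_le₀ le_add_self zero_le
          exact ENNReal.coe_le_one_iff.mpr this
      _ = 1 := by simp
  have hne : ∀ n ∈ Finset.univ,
      ∫⁻ x : Fin N → ℝ≥0, ((x n / (zeta κ ρ c * ρ + l1 x) : ℝ≥0) : ℝ≥0∞) ∂κ ≠ ∞ := fun n hn =>
    ne_top_of_le_ne_top ENNReal.one_ne_top
      ((Finset.single_le_sum (fun _ _ => zero_le) hn).trans hsum)
  unfold optimalShare
  rw [← ENNReal.toNNReal_sum hne]
  exact ENNReal.toNNReal_mono ENNReal.one_ne_top hsum |>.trans (by simp)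

end Root

/-- The strategy `Λ̂`: `Λ̂_{t+1}^n(ω, χ_t) = ∫ xⁿ / (ζ_{t+1}(ω, C_t(ω, χ_t)) ρ_{t+1}(ω) + |x|)
K_{t+1}(ω, dx)`, where `K t` stands for `K_{t+1}`. -/
noncomputable def optimalRule {Ω : Type*} {m0 : MeasurableSpace Ω} {M N : ℕ}
    (X : ℕ → Ω → Fin N → ℝ≥0) (ρ : ℕ → Ω → ℝ≥0) (ℱ : Filtration ℕ m0)
    (K : (t : ℕ) → @Kernel Ω (Fin N → ℝ≥0) (ℱ t) _) [∀ t, IsMarkovKernel (K t)] :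
    Rule Ω M N :=
  fun t ω y₀ h =>
    ⟨optimalShare (K t ω) (ρ (t + 1) ω) (totalWealthOf X ρ ω y₀ t h),
      sum_optimalShare_le _ _ _⟩

end AssetMarketGame

open AssetMarketGame

/-
Let `D(x) = ζ ρ + |x|`. This is the next total wealth of a market with total wealth `c` in which
everybody uses `λ̂`, and the equation for `ζ` says that the share of the bank account in `λ̂` is
`1 - ∑ λ̂ⁿ = ζ / c`.

Suppose that the whole market invests the proportions `b` on average and that a coalition with
relative wealth `q` uses `λ̂`. Its next relative wealth is `q A(x) / W(x)`, where
`A(x) = ζ ρ + ∑ (λ̂ⁿ / bⁿ) xⁿ` and `W(x) ≤ c ρ (1 - ∑ bⁿ) + |x|`. Jensen's inequality for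
`log (A / D)`, with the weights `ζ ρ / D` and `xⁿ / D`, and `log u ≤ u - 1` for `u = W / D` bound
the increment of the log-share from below by an integrable function whose integral is at least
the relative entropy `∑ bⁿ klFun (λ̂ⁿ / bⁿ)`, which is nonnegative and vanishes only if `b = λ̂`.

For the coalition `{m}` this is relative growth optimality. For uniqueness, let all the others
switch to `λ̂` at time `t`: unless investor `m` plays `λ̂` too, or owns the whole market, the
coalition `{m}ᶜ` gains strictly on average, so that `r^m` is not a submartingale. By induction
on `t`, the two markets therefore have the same history as long as `r^m ≠ 1`.
-/

namespace AssetMarketGame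

theorem lintegral_ofReal_le_ofReal_integral {α : Type*} [MeasurableSpace α] {μ : Measure α}
    {f g : α → ℝ} (hg : Integrable g μ) (hf : ∀ x, 0 ≤ f x) (hfg : f ≤ᵐ[μ] g) :
    ∫⁻ x, ENNReal.ofReal (f x) ∂μ ≤ ENNReal.ofReal (∫ x, g x ∂μ) := by
  rw [ofReal_integral_eq_lintegral_ofReal hg (hfg.mono fun x hx => (hf x).trans hx)]
  exact lintegral_mono_ae (hfg.mono fun x hx => ENNReal.ofReal_le_ofReal hx)

section LogInequalities

theorem mul_klFun_div {a b : ℝ} (h : b = 0 → a = 0) :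
    b * InformationTheory.klFun (a / b) = a * Real.log (a / b) - (a - b) := by
  rcases eq_or_ne b 0 with hb | hb
  · simp [hb, h hb]
  · rw [InformationTheory.klFun_apply]
    field_simp
    ring

variable {ι : Type*} [Fintype ι] {w : ℝ} {x u : ι → ℝ}

theorem add_sum_mul_pos (hw : 0 ≤ w) (hx : ∀ i, 0 ≤ x i) (hd : 0 < w + ∑ i, x i)
    (hu : ∀ i, x i ≠ 0 → 0 < u i) : 0 < w + ∑ i, x i * u i := by
  have hterm (i : ι) : 0 ≤ x i * u i := by
    rcases eq_or_ne (x i) 0 with h | h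
    · simp [h]
    · exact mul_nonneg (hx i) (hu i h).le
  by_cases hall : ∀ i, x i = 0
  · simpa [hall] using hd
  · obtain ⟨i, hi⟩ := not_forall.mp hall
    refine add_pos_of_nonneg_of_pos hw
      (Finset.sum_pos' (fun i _ => hterm i) ⟨i, Finset.mem_univ i, ?_⟩)
    exact mul_pos ((hx i).lt_of_ne' hi) (hu i hi)

theorem sum_mul_log_le_mul_log (hw : 0 ≤ w) (hx : ∀ i, 0 ≤ x i) (hd : 0 < w + ∑ i, x i)
    (hu : ∀ i, x i ≠ 0 → 0 < u i) :
    ∑ i, x i * Real.log (u i) ≤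
      (w + ∑ i, x i) * Real.log ((w + ∑ i, x i * u i) / (w + ∑ i, x i)) := by
  have hs := add_sum_mul_pos hw hx hd hu
  set r := (w + ∑ i, x i * u i) / (w + ∑ i, x i) with hr_def
  have hr : 0 < r := div_pos hs hd
  have hterm (i : ι) : x i * Real.log (u i) ≤ x i * (u i / r - 1 + Real.log r) := by
    rcases eq_or_ne (x i) 0 with h | h
    · simp [h]
    · have := Real.log_le_sub_one_of_pos (div_pos (hu i h) hr)
      rw [Real.log_div (hu i h).ne' hr.ne'] at this
      exact mul_le_mul_of_nonneg_left (by linarith) (hx i)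
  have hconst : 0 ≤ w * (1 / r - 1 + Real.log r) := by
    have := Real.log_le_sub_one_of_pos (inv_pos.mpr hr)
    rw [Real.log_inv] at this
    exact mul_nonneg hw (by rw [one_div]; linarith)
  have hcancel : (w + ∑ i, x i * u i) / r = w + ∑ i, x i := by
    rw [hr_def, div_div_cancel₀ hs.ne']
  calc ∑ i, x i * Real.log (u i)
      ≤ w * (1 / r - 1 + Real.log r) + ∑ i, x i * (u i / r - 1 + Real.log r) :=
        (Finset.sum_le_sum fun i _ => hterm i).trans (le_add_of_nonneg_left hconst)
    _ = (w + ∑ i, x i * u i) / r - (w + ∑ i, x i) + (w + ∑ i, x i) * Real.log r := by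
        simp only [mul_add, mul_sub, Finset.sum_add_distrib, Finset.sum_sub_distrib, add_div,
          add_mul, Finset.sum_mul, Finset.sum_div, mul_div_assoc, mul_one]
        ring
    _ = (w + ∑ i, x i) * Real.log r := by rw [hcancel, sub_self, zero_add]

end LogInequalities

section Root

variable {N : ℕ}

theorem coe_l1 (x : Fin N → ℝ≥0) : (l1 x : ℝ) = ∑ n, (x n : ℝ) := NNReal.coe_sum ..

attribute [fun_prop] measurable_l1

theorem mul_pos_of_inGamma {κ : Measure (Fin N → ℝ≥0)} {ρ c : ℝ≥0} (h : InGamma κ ρ c) :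
    0 < c * ρ := by
  rw [pos_iff_ne_zero]
  intro h0
  simp [InGamma, h0] at h

variable (κ : Measure (Fin N → ℝ≥0)) [IsProbabilityMeasure κ] (ρ c : ℝ≥0)

variable {κ ρ c} in
theorem isRoot_zeta (h : InGamma κ ρ c) : IsRoot κ ρ c (zeta κ ρ c) := by
  rw [zeta, dif_pos h]
  exact (existsUnique_root κ ρ c h).choose_spec.1

variable {κ ρ c} in
theorem zeta_eq_zero_of_not_inGamma (h : ¬ InGamma κ ρ c) : zeta κ ρ c = 0 := dif_neg h

variable {κ ρ c} in
theorem lt_zeta_iff {z : ℝ≥0} : z < zeta κ ρ c ↔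
    1 < ∫⁻ x, ((c * ρ : ℝ≥0) : ℝ≥0∞) / ((z * ρ + l1 x : ℝ≥0) : ℝ≥0∞) ∂κ := by
  constructor
  · intro hz
    have hG : InGamma κ ρ c := by
      by_contra hG
      simp [zeta_eq_zero_of_not_inGamma hG] at hz
    have hcρ := mul_pos_of_inGamma hG
    have hρ : 0 < ρ := pos_of_mul_pos_right hcρ zero_le
    have hroot := (isRoot_zeta hG).2.2
    rw [← hroot]
    refine lintegral_strict_mono (IsProbabilityMeasure.ne_zero κ) (by fun_prop)
      (hroot ▸ ENNReal.one_ne_top)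
      (.of_forall fun x => ENNReal.div_lt_div_left ?_ ENNReal.coe_ne_top ?_)
    · exact_mod_cast hcρ.ne'
    · exact_mod_cast add_lt_add_left (mul_lt_mul_of_pos_right hz hρ) _
  · intro hz
    have hG : InGamma κ ρ c := hz.trans_le (lintegral_mono fun x => by gcongr; exact le_add_self)
    contrapose! hz
    rw [← (isRoot_zeta hG).2.2]
    gcongr

/-- The wealth after one step of a market with total wealth `c` in which every investor holds the
optimal portfolio: the denominator `ζ ρ + |x|` in the definition of `Λ̂`. -/
noncomputable def optimalWealth (x : Fin N → ℝ≥0) : ℝ≥0 := zeta κ ρ c * ρ + l1 x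

@[fun_prop]
theorem measurable_optimalWealth : Measurable (optimalWealth κ ρ c) := by
  unfold optimalWealth
  fun_prop

theorem coe_optimalWealth (x : Fin N → ℝ≥0) :
    (optimalWealth κ ρ c x : ℝ) = zeta κ ρ c * ρ + ∑ n, (x n : ℝ) := by
  rw [← coe_l1]
  rfl

theorem lintegral_div_optimalWealth_le_one :
    ∫⁻ x, ((c * ρ : ℝ≥0) : ℝ≥0∞) / (optimalWealth κ ρ c x : ℝ≥0∞) ∂κ ≤ 1 :=
  not_lt.mp fun h => lt_irrefl _ (lt_zeta_iff.mpr h)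

theorem ae_div_optimalWealth_lt_top :
    ∀ᵐ x ∂κ, ((c * ρ : ℝ≥0) : ℝ≥0∞) / (optimalWealth κ ρ c x : ℝ≥0∞) < ∞ :=
  ae_lt_top (by fun_prop)
    ((lintegral_div_optimalWealth_le_one κ ρ c).trans_lt ENNReal.one_lt_top).ne

variable {κ ρ c} in
theorem ae_optimalWealth_pos (hc : 0 < c) (hκ : ∀ᵐ x ∂κ, 0 < ρ + l1 x) :
    ∀ᵐ x ∂κ, 0 < optimalWealth κ ρ c x := by
  filter_upwards [ae_div_optimalWealth_lt_top κ ρ c, hκ] with x hfin hx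
  rw [pos_iff_ne_zero]
  intro h0
  have hx0 : l1 x = 0 := (add_eq_zero.mp h0).2
  have hρ : 0 < ρ := by simpa [hx0] using hx
  rw [h0, ENNReal.coe_zero, ENNReal.div_zero (by exact_mod_cast (mul_pos hc hρ).ne')] at hfin
  exact hfin.false

theorem integrable_div_optimalWealth :
    Integrable (fun x => (c * ρ / optimalWealth κ ρ c x : ℝ)) κ := by
  simpa [ENNReal.toReal_div] using integrable_toReal_of_lintegral_ne_top (by fun_prop)
    ((lintegral_div_optimalWealth_le_one κ ρ c).trans_lt ENNReal.one_lt_top).ne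

theorem integral_div_optimalWealth :
    ∫ x, (c * ρ / optimalWealth κ ρ c x : ℝ) ∂κ =
      (∫⁻ x, ((c * ρ : ℝ≥0) : ℝ≥0∞) / (optimalWealth κ ρ c x : ℝ≥0∞) ∂κ).toReal := by
  rw [← integral_toReal (by fun_prop) (ae_div_optimalWealth_lt_top κ ρ c)]
  simp [ENNReal.toReal_div]

theorem integral_div_optimalWealth_le_one :
    ∫ x, (c * ρ / optimalWealth κ ρ c x : ℝ) ∂κ ≤ 1 := by
  rw [integral_div_optimalWealth]
  exact ENNReal.toReal_mono ENNReal.one_ne_top (lintegral_div_optimalWealth_le_one κ ρ c)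

theorem zeta_mul_integral_div_optimalWealth :
    zeta κ ρ c * ∫ x, (c * ρ / optimalWealth κ ρ c x : ℝ) ∂κ = zeta κ ρ c := by
  by_cases hG : InGamma κ ρ c
  · have hroot : ∫⁻ x, ((c * ρ : ℝ≥0) : ℝ≥0∞) / (optimalWealth κ ρ c x : ℝ≥0∞) ∂κ = 1 :=
      (isRoot_zeta hG).2.2
    rw [integral_div_optimalWealth, hroot, ENNReal.toReal_one, mul_one]
  · simp [zeta_eq_zero_of_not_inGamma hG]

theorem apply_le_optimalWealth (x : Fin N → ℝ≥0) (n : Fin N) : x n ≤ optimalWealth κ ρ c x :=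
  (Finset.single_le_sum (fun _ _ => zero_le) (Finset.mem_univ n)).trans le_add_self

theorem integrable_apply_div_optimalWealth (n : Fin N) :
    Integrable (fun x => (x n / optimalWealth κ ρ c x : ℝ)) κ := by
  refine .of_bound (by fun_prop : Measurable _).aestronglyMeasurable 1 (.of_forall fun x => ?_)
  rw [Real.norm_of_nonneg (by positivity)]
  exact div_le_one_of_le₀ (by exact_mod_cast apply_le_optimalWealth κ ρ c x n) (by positivity)

theorem optimalShare_eq_integral (n : Fin N) :
    (optimalShare κ ρ c n : ℝ) = ∫ x, (x n / optimalWealth κ ρ c x : ℝ) ∂κ := by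
  have h := integral_toReal (μ := κ) (f := fun x => ((x n / optimalWealth κ ρ c x : ℝ≥0) : ℝ≥0∞))
    (by fun_prop) (.of_forall fun x => ENNReal.coe_lt_top)
  simp only [ENNReal.coe_toReal, NNReal.coe_div] at h
  exact h.symm

theorem ae_optimalShare_ne_zero : ∀ᵐ x ∂κ, ∀ n, x n ≠ 0 → optimalShare κ ρ c n ≠ 0 := by
  refine ae_all_iff.mpr fun n => ?_
  by_cases h : optimalShare κ ρ c n = 0
  · have hzero := optimalShare_eq_integral κ ρ c n
    rw [h, NNReal.coe_zero, eq_comm, integral_eq_zero_iff_of_nonneg (fun x => by positivity)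
      (integrable_apply_div_optimalWealth κ ρ c n)] at hzero
    filter_upwards [hzero] with x hx hxn
    have hle := apply_le_optimalWealth κ ρ c x n
    have hpos : 0 < x n := pos_iff_ne_zero.mpr hxn
    have hdiv : 0 < (x n / optimalWealth κ ρ c x : ℝ) := by
      have := hpos.trans_le hle
      positivity
    exact absurd hx hdiv.ne'
  · exact .of_forall fun _ _ => h

variable {κ ρ c} in
theorem zeta_eq_mul_one_sub_sum_optimalShare (hc : 0 < c) (hκ : ∀ᵐ x ∂κ, 0 < ρ + l1 x) :
    (zeta κ ρ c : ℝ) = c * (1 - ∑ n, (optimalShare κ ρ c n : ℝ)) := by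
  have hpt : ∀ᵐ x ∂κ, (zeta κ ρ c : ℝ) * (c * ρ / optimalWealth κ ρ c x) =
      c - c * ∑ n, (x n / optimalWealth κ ρ c x : ℝ) := by
    filter_upwards [ae_optimalWealth_pos hc hκ] with x hx
    have hx' : (optimalWealth κ ρ c x : ℝ) ≠ 0 := by exact_mod_cast hx.ne'
    rw [← Finset.sum_div]
    field_simp
    rw [coe_optimalWealth]
    ring
  have hint (n : Fin N) := integrable_apply_div_optimalWealth κ ρ c n
  have h := integral_congr_ae hpt
  rw [integral_const_mul, zeta_mul_integral_div_optimalWealth, integral_sub (integrable_const _)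
    ((integrable_finsetSum _ fun n _ => hint n).const_mul _), integral_const_mul,
    integral_finsetSum _ fun n _ => hint n] at h
  simp only [← optimalShare_eq_integral, integral_const, probReal_univ, one_smul] at h
  rw [h]
  ring

end Root

section RootMeasurability

variable {α : Type*} [MeasurableSpace α] {N : ℕ} (κ : Kernel α (Fin N → ℝ≥0)) [IsMarkovKernel κ]
  {ρ c : α → ℝ≥0}

theorem measurable_zeta (hρ : Measurable ρ) (hc : Measurable c) :
    Measurable fun a => zeta (κ a) (ρ a) (c a) := by
  refine measurable_of_Ioi fun z => ?_
  simp only [Set.preimage, Set.mem_Ioi, lt_zeta_iff]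
  refine measurableSet_lt measurable_const (Measurable.lintegral_kernel_prod_right ?_)
  unfold Function.uncurry
  fun_prop

theorem measurable_optimalShare (hρ : Measurable ρ) (hc : Measurable c) (n : Fin N) :
    Measurable fun a => optimalShare (κ a) (ρ a) (c a) n := by
  have hζ : Measurable fun p : α × (Fin N → ℝ≥0) => zeta (κ p.1) (ρ p.1) (c p.1) :=
    (measurable_zeta κ hρ hc).comp measurable_fst
  refine Measurable.ennreal_toNNReal (Measurable.lintegral_kernel_prod_right ?_)
  unfold Function.uncurry
  fun_prop

end RootMeasurability

section Growth

variable {N : ℕ} (κ : Measure (Fin N → ℝ≥0)) [IsProbabilityMeasure κ] (ρ c : ℝ≥0)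
  (b : Fin N → ℝ≥0)

/-- The wealth after one step of an investor with capital `c` and the optimal portfolio, when
the market invests the proportions `b` on average. -/
noncomputable def optimalPayoff (x : Fin N → ℝ≥0) : ℝ :=
  zeta κ ρ c * ρ + ∑ n, x n * (optimalShare κ ρ c n / b n : ℝ)

/-- An integrable lower bound for the logarithm of the growth of the optimal portfolio relative
to a market which invests the proportions `b` on average. -/
noncomputable def growthMinorant (x : Fin N → ℝ≥0) : ℝ :=
  ∑ n, x n / optimalWealth κ ρ c x * Real.log (optimalShare κ ρ c n / b n) -
    (∑ n, (optimalShare κ ρ c n : ℝ) - ∑ n, (b n : ℝ)) * (c * ρ / optimalWealth κ ρ c x)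

theorem integrable_growthMinorant : Integrable (growthMinorant κ ρ c b) κ :=
  (integrable_finsetSum _ fun n _ =>
    (integrable_apply_div_optimalWealth κ ρ c n).mul_const _).sub
    ((integrable_div_optimalWealth κ ρ c).const_mul _)

theorem integral_growthMinorant : ∫ x, growthMinorant κ ρ c b x ∂κ =
    ∑ n, optimalShare κ ρ c n * Real.log (optimalShare κ ρ c n / b n) -
      (∑ n, (optimalShare κ ρ c n : ℝ) - ∑ n, (b n : ℝ)) *
        ∫ x, (c * ρ / optimalWealth κ ρ c x : ℝ) ∂κ := by
  have hint (n : Fin N) := (integrable_apply_div_optimalWealth κ ρ c n).mul_const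
    (Real.log (optimalShare κ ρ c n / b n))
  simp only [growthMinorant]
  rw [integral_sub (integrable_finsetSum _ fun n _ => hint n)
    ((integrable_div_optimalWealth κ ρ c).const_mul _), integral_finsetSum _ fun n _ => hint n,
    integral_const_mul]
  simp only [integral_mul_const, optimalShare_eq_integral]

variable {κ ρ c b}

theorem sum_mul_klFun_le_integral_growthMinorant (hc : 0 < c) (hκ : ∀ᵐ x ∂κ, 0 < ρ + l1 x)
    (hb1 : ∑ n, b n ≤ 1) (hb : ∀ n, b n = 0 → optimalShare κ ρ c n = 0) :
    ∑ n, b n * InformationTheory.klFun (optimalShare κ ρ c n / b n) ≤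
      ∫ x, growthMinorant κ ρ c b x ∂κ := by
  set l := optimalShare κ ρ c
  set I := ∫ x, (c * ρ / optimalWealth κ ρ c x : ℝ) ∂κ
  have hc' : (c : ℝ) ≠ 0 := by exact_mod_cast hc.ne'
  have hI : I ≤ 1 := integral_div_optimalWealth_le_one κ ρ c
  have hroot : (1 - ∑ n, (l n : ℝ)) * (1 - I) = 0 := by
    have h : (zeta κ ρ c : ℝ) * I = zeta κ ρ c := zeta_mul_integral_div_optimalWealth κ ρ c
    rw [zeta_eq_mul_one_sub_sum_optimalShare hc hκ] at h
    exact (mul_eq_zero.mp (by linear_combination -h :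
      c * ((1 - ∑ n, (l n : ℝ)) * (1 - I)) = 0)).resolve_left hc'
  have hgap : 0 ≤ (∑ n, (l n : ℝ) - ∑ n, (b n : ℝ)) * (1 - I) := by
    have hb1' : ∑ n, (b n : ℝ) ≤ 1 := by exact_mod_cast hb1
    calc 0 ≤ (1 - ∑ n, (b n : ℝ)) * (1 - I) :=
          mul_nonneg (sub_nonneg.mpr hb1') (sub_nonneg.mpr hI)
      _ = _ := by linear_combination hroot
  have hkl : ∑ n, b n * InformationTheory.klFun (l n / b n) =
      ∑ n, l n * Real.log (l n / b n) - (∑ n, (l n : ℝ) - ∑ n, (b n : ℝ)) := by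
    rw [← Finset.sum_sub_distrib, ← Finset.sum_sub_distrib]
    exact Finset.sum_congr rfl fun n _ => mul_klFun_div (by exact_mod_cast hb n)
  rw [integral_growthMinorant, hkl]
  linarith

theorem integral_growthMinorant_nonneg (hc : 0 < c) (hκ : ∀ᵐ x ∂κ, 0 < ρ + l1 x)
    (hb1 : ∑ n, b n ≤ 1) (hb : ∀ n, b n = 0 → optimalShare κ ρ c n = 0) :
    0 ≤ ∫ x, growthMinorant κ ρ c b x ∂κ :=
  (Finset.sum_nonneg fun n _ => mul_nonneg (NNReal.coe_nonneg _)
    (InformationTheory.klFun_nonneg (by positivity))).trans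
    (sum_mul_klFun_le_integral_growthMinorant hc hκ hb1 hb)

theorem integral_growthMinorant_pos (hc : 0 < c) (hκ : ∀ᵐ x ∂κ, 0 < ρ + l1 x)
    (hb1 : ∑ n, b n ≤ 1) (hb : ∀ n, b n = 0 → optimalShare κ ρ c n = 0)
    (hne : b ≠ optimalShare κ ρ c) : 0 < ∫ x, growthMinorant κ ρ c b x ∂κ := by
  obtain ⟨n, hn⟩ := Function.ne_iff.mp hne
  refine lt_of_lt_of_le (Finset.sum_pos' (fun i _ => ?_) ⟨n, Finset.mem_univ n, ?_⟩)
    (sum_mul_klFun_le_integral_growthMinorant hc hκ hb1 hb)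
  · exact mul_nonneg (NNReal.coe_nonneg _) (InformationTheory.klFun_nonneg (by positivity))
  · have hbn : b n ≠ 0 := fun h => hn (h.trans (hb n h).symm)
    have hbn' : (b n : ℝ) ≠ 0 := by exact_mod_cast hbn
    refine mul_pos (by exact_mod_cast pos_iff_ne_zero.mpr hbn)
      ((InformationTheory.klFun_nonneg (by positivity)).lt_of_ne' fun h => hn ?_)
    rw [InformationTheory.klFun_eq_zero_iff (by positivity), div_eq_one_iff_eq hbn'] at h
    exact_mod_cast h.symm

theorem ae_optimalShare_div_pos (hb : ∀ n, b n = 0 → optimalShare κ ρ c n = 0) :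
    ∀ᵐ x ∂κ, ∀ n, (x n : ℝ) ≠ 0 → 0 < (optimalShare κ ρ c n / b n : ℝ) := by
  filter_upwards [ae_optimalShare_ne_zero κ ρ c] with x hx n hxn
  have hl : optimalShare κ ρ c n ≠ 0 := hx n (by exact_mod_cast hxn)
  have hbn : b n ≠ 0 := fun h => hl (hb n h)
  exact_mod_cast div_pos (pos_iff_ne_zero.mpr hl) (pos_iff_ne_zero.mpr hbn)

theorem ae_optimalPayoff_pos (hc : 0 < c) (hκ : ∀ᵐ x ∂κ, 0 < ρ + l1 x)
    (hb : ∀ n, b n = 0 → optimalShare κ ρ c n = 0) : ∀ᵐ x ∂κ, 0 < optimalPayoff κ ρ c b x := by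
  filter_upwards [ae_optimalWealth_pos hc hκ, ae_optimalShare_div_pos hb] with x hD hu
  exact add_sum_mul_pos (by positivity) (fun n => NNReal.coe_nonneg _)
    (by rw [← coe_optimalWealth]; exact_mod_cast hD) hu

theorem ae_growthMinorant_le_log_div (hc : 0 < c) (hκ : ∀ᵐ x ∂κ, 0 < ρ + l1 x)
    (hb : ∀ n, b n = 0 → optimalShare κ ρ c n = 0) :
    ∀ᵐ x ∂κ, ∀ W : ℝ, 0 < W → W ≤ c * ρ * (1 - ∑ n, (b n : ℝ)) + l1 x →
      growthMinorant κ ρ c b x ≤ Real.log (optimalPayoff κ ρ c b x / W) := by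
  filter_upwards [ae_optimalWealth_pos hc hκ, ae_optimalShare_div_pos hb,
    ae_optimalPayoff_pos hc hκ hb] with x hDpos hu hA W hW hWle
  have hD : (optimalWealth κ ρ c x : ℝ) = zeta κ ρ c * ρ + ∑ n, (x n : ℝ) :=
    coe_optimalWealth κ ρ c x
  have hζ := zeta_eq_mul_one_sub_sum_optimalShare hc hκ
  rw [growthMinorant]
  set D := (optimalWealth κ ρ c x : ℝ)
  have hD0 : 0 < D := by exact_mod_cast hDpos
  have hjensen : ∑ n, x n / D * Real.log (optimalShare κ ρ c n / b n) ≤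
      Real.log (optimalPayoff κ ρ c b x / D) := by
    have h := sum_mul_log_le_mul_log (by positivity) (fun n => NNReal.coe_nonneg (x n))
      (hD ▸ hD0) hu
    rw [← hD] at h
    simp only [div_mul_eq_mul_div]
    rw [← Finset.sum_div, div_le_iff₀' hD0]
    exact h
  have hmarket : Real.log (W / D) ≤
      (∑ n, (optimalShare κ ρ c n : ℝ) - ∑ n, (b n : ℝ)) * (c * ρ / D) :=
    calc Real.log (W / D) ≤ W / D - 1 := Real.log_le_sub_one_of_pos (div_pos hW hD0)
      _ ≤ (c * ρ * (1 - ∑ n, (b n : ℝ)) + l1 x) / D - 1 := by gcongr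
      _ = _ := by
        field_simp
        rw [hD, coe_l1, hζ]
        ring
  have hsplit : Real.log (optimalPayoff κ ρ c b x / W) =
      Real.log (optimalPayoff κ ρ c b x / D) - Real.log (W / D) := by
    rw [← Real.log_div (div_pos hA hD0).ne' (div_pos hW hD0).ne', div_div_div_cancel_right₀ hD0.ne']
  linarith

end Growth

section WealthShare

variable {ι : Type*} [Fintype ι] (S : Finset ι) (y : ι → ℝ≥0)

/-- The share of the coalition `S` in the total wealth, with `0 / 0 = 0`. -/
noncomputable def wealthShare : ℝ := (∑ k ∈ S, (y k : ℝ)) / ∑ k, (y k : ℝ)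

theorem wealthShare_nonneg : 0 ≤ wealthShare S y := by
  unfold wealthShare
  positivity

theorem wealthShare_le_one : wealthShare S y ≤ 1 :=
  div_le_one_of_le₀ (Finset.sum_le_univ_sum_of_nonneg fun _ => NNReal.coe_nonneg _) (by positivity)

theorem neg_log_wealthShare_nonneg : 0 ≤ -Real.log (wealthShare S y) :=
  neg_nonneg.mpr (Real.log_nonpos (wealthShare_nonneg S y) (wealthShare_le_one S y))

variable {S y}

theorem sum_pos_of_wealthShare_pos (h : 0 < wealthShare S y) : 0 < ∑ k ∈ S, y k := by
  have h' := (div_pos_iff_of_pos_right (show (0 : ℝ) < ∑ k, (y k : ℝ) from ?_)).mp h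
  · exact_mod_cast h'
  · refine lt_of_le_of_ne (by positivity) fun h0 => ?_
    simp [wealthShare, ← h0] at h

theorem sum_univ_pos_of_wealthShare_pos (h : 0 < wealthShare S y) : 0 < ∑ k, y k :=
  (sum_pos_of_wealthShare_pos h).trans_le (Finset.sum_le_univ_sum_of_nonneg fun _ => zero_le)

theorem wealthShare_compl [DecidableEq ι] (hy : 0 < ∑ k, y k) :
    wealthShare Sᶜ y = 1 - wealthShare S y := by
  have hy' : (∑ k, (y k : ℝ)) ≠ 0 := by exact_mod_cast hy.ne'
  rw [eq_sub_iff_add_eq', wealthShare, wealthShare, ← add_div, Finset.sum_add_sum_compl,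
    div_self hy']

end WealthShare

section Coalition

variable {M N : ℕ} (ρ : ℝ≥0) (x : Fin N → ℝ≥0) (a : Fin M → Action N) (y : Fin M → ℝ≥0)

/-- The proportions which the whole market invests in the assets: the averages of the proportions
`a` of the investors, weighted by their wealth `y`. -/
noncomputable def marketPortfolio (n : Fin N) : ℝ≥0 := (∑ k, (a k).1 n * y k) / ∑ k, y k

theorem sum_marketPortfolio_le_one : ∑ n, marketPortfolio a y n ≤ 1 := by
  simp only [marketPortfolio]
  rw [← Finset.sum_div, Finset.sum_comm]
  refine div_le_one_of_le₀ (Finset.sum_le_sum fun k _ => ?_) zero_le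
  rw [← Finset.sum_mul]
  exact mul_le_of_le_one_left zero_le (a k).2

variable {y} in
theorem marketPortfolio_mul_sum (hy : 0 < ∑ k, y k) (n : Fin N) :
    marketPortfolio a y n * ∑ k, y k = ∑ k, (a k).1 n * y k :=
  div_mul_cancel₀ _ hy.ne'

theorem coe_wealthStep (k : Fin M) : (wealthStep ρ x a y k : ℝ) =
    ρ * (1 - ∑ n, ((a k).1 n : ℝ)) * y k +
      ∑ n, ((a k).1 n * y k / (∑ j, (a j).1 n * y j) * x n : ℝ) := by
  rw [wealthStep]
  push_cast [NNReal.coe_sub (a k).2]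
  rfl

variable {y} in
theorem sum_wealthStep_le (hy : 0 < ∑ k, y k) : ∑ k, (wealthStep ρ x a y k : ℝ) ≤
    (∑ k, y k : ℝ≥0) * ρ * (1 - ∑ n, (marketPortfolio a y n : ℝ)) + l1 x := by
  simp only [coe_wealthStep, Finset.sum_add_distrib]
  refine add_le_add (le_of_eq ?_) ?_
  · have hb : (∑ k, y k : ℝ≥0) * ∑ n, (marketPortfolio a y n : ℝ) =
        ∑ k, (∑ n, ((a k).1 n : ℝ)) * y k := by
      simp only [Finset.sum_mul]
      rw [Finset.sum_comm, Finset.mul_sum]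
      refine Finset.sum_congr rfl fun n _ => ?_
      rw [mul_comm]
      exact_mod_cast marketPortfolio_mul_sum a hy n
    simp only [mul_sub, sub_mul, mul_one, mul_assoc, Finset.sum_sub_distrib, ← Finset.mul_sum]
    rw [← hb]
    push_cast
    ring
  · rw [Finset.sum_comm, coe_l1]
    refine Finset.sum_le_sum fun n _ => ?_
    rw [← Finset.sum_mul, ← Finset.sum_div]
    push_cast
    exact mul_le_of_le_one_left (NNReal.coe_nonneg _) (div_self_le_one _)

variable {a y}

theorem eq_of_marketPortfolio_eq {m : Fin M} {l : Fin N → ℝ≥0} (hym : 0 < y m)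
    (ha : ∀ k ≠ m, (a k).1 = l) (h : marketPortfolio a y = l) : (a m).1 = l := by
  funext n
  have hy : 0 < ∑ k, y k := Finset.sum_pos_iff.mpr ⟨m, Finset.mem_univ m, hym⟩
  have hn := marketPortfolio_mul_sum a hy n
  rw [h, Finset.mul_sum, ← Finset.add_sum_erase _ _ (Finset.mem_univ m),
    ← Finset.add_sum_erase _ _ (Finset.mem_univ m),
    Finset.sum_congr rfl fun k hk => by rw [← ha k (Finset.ne_of_mem_erase hk)]] at hn
  exact (mul_right_cancel₀ hym.ne' (add_right_cancel hn)).symm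

variable {S : Finset (Fin M)} {l : Fin N → ℝ≥0}

theorem eq_zero_of_marketPortfolio_eq_zero (hS : ∀ k ∈ S, (a k).1 = l) (hq : 0 < wealthShare S y)
    {n : Fin N} (h : marketPortfolio a y n = 0) : l n = 0 := by
  have hn := marketPortfolio_mul_sum a (sum_univ_pos_of_wealthShare_pos hq) n
  rw [h, zero_mul, eq_comm, Finset.sum_eq_zero_iff] at hn
  obtain ⟨k, hk, hyk⟩ := Finset.sum_pos_iff.mp (sum_pos_of_wealthShare_pos hq)
  rw [← hS k hk]
  exact (mul_eq_zero.mp (hn k (Finset.mem_univ k))).resolve_right hyk.ne'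

variable {κ : Measure (Fin N → ℝ≥0)} [IsProbabilityMeasure κ] {ρ}

theorem sum_coalition_wealthStep (hS : ∀ k ∈ S, (a k).1 = optimalShare κ ρ (∑ k, y k))
    (hy : 0 < ∑ k, y k) (hκ : ∀ᵐ x ∂κ, 0 < ρ + l1 x) :
    ∑ k ∈ S, (wealthStep ρ x a y k : ℝ) =
      wealthShare S y * optimalPayoff κ ρ (∑ k, y k) (marketPortfolio a y) x := by
  have hy' : (∑ k, (y k : ℝ)) ≠ 0 := by exact_mod_cast hy.ne'
  have hstep (k : Fin M) (hk : k ∈ S) : (wealthStep ρ x a y k : ℝ) =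
      y k / (∑ k, (y k : ℝ)) * optimalPayoff κ ρ (∑ k, y k) (marketPortfolio a y) x := by
    rw [coe_wealthStep, hS k hk, optimalPayoff, zeta_eq_mul_one_sub_sum_optimalShare hy hκ, mul_add,
      Finset.mul_sum]
    congr 1
    · push_cast
      field_simp
    · refine Finset.sum_congr rfl fun n _ => ?_
      rw [marketPortfolio]
      push_cast
      rw [div_div_eq_mul_div]
      field_simp
  rw [Finset.sum_congr rfl hstep, ← Finset.sum_mul, wealthShare, Finset.sum_div]

theorem ae_growthMinorant_le_log_wealthShare_wealthStep
    (hS : ∀ k ∈ S, (a k).1 = optimalShare κ ρ (∑ k, y k)) (hq : 0 < wealthShare S y)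
    (hκ : ∀ᵐ x ∂κ, 0 < ρ + l1 x) :
    ∀ᵐ x ∂κ, 0 < wealthShare S (wealthStep ρ x a y) ∧
      Real.log (wealthShare S y) + growthMinorant κ ρ (∑ k, y k) (marketPortfolio a y) x ≤
        Real.log (wealthShare S (wealthStep ρ x a y)) := by
  have hy := sum_univ_pos_of_wealthShare_pos hq
  have hb (n : Fin N) := eq_zero_of_marketPortfolio_eq_zero hS hq (n := n)
  filter_upwards [ae_optimalPayoff_pos hy hκ hb, ae_growthMinorant_le_log_div hy hκ hb]
    with x hA hH
  set A := optimalPayoff κ ρ (∑ k, y k) (marketPortfolio a y) x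
  set W := ∑ k, (wealthStep ρ x a y k : ℝ)
  have hYS : ∑ k ∈ S, (wealthStep ρ x a y k : ℝ) = wealthShare S y * A :=
    sum_coalition_wealthStep x hS hy hκ
  have hW : 0 < W := calc
    0 < ∑ k ∈ S, (wealthStep ρ x a y k : ℝ) := hYS ▸ mul_pos hq hA
    _ ≤ W := Finset.sum_le_univ_sum_of_nonneg fun _ => NNReal.coe_nonneg _
  have hshare : wealthShare S (wealthStep ρ x a y) = wealthShare S y * (A / W) := by
    rw [wealthShare, hYS, mul_div_assoc]
  have hAW : 0 < A / W := div_pos hA hW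
  rw [hshare, Real.log_mul hq.ne' hAW.ne']
  exact ⟨mul_pos hq hAW, by gcongr; exact hH W hW (sum_wealthStep_le ρ x a hy)⟩

theorem lintegral_neg_log_wealthShare_wealthStep_le
    (hS : ∀ k ∈ S, (a k).1 = optimalShare κ ρ (∑ k, y k)) (hq : 0 < wealthShare S y)
    (hκ : ∀ᵐ x ∂κ, 0 < ρ + l1 x) :
    ∫⁻ x, ENNReal.ofReal (-Real.log (wealthShare S (wealthStep ρ x a y))) ∂κ ≤
      ENNReal.ofReal (-Real.log (wealthShare S y)) := by
  set H := growthMinorant κ ρ (∑ k, y k) (marketPortfolio a y)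
  have hH : Integrable H κ := integrable_growthMinorant ..
  have hH0 : 0 ≤ ∫ x, H x ∂κ :=
    integral_growthMinorant_nonneg (sum_univ_pos_of_wealthShare_pos hq) hκ
      (sum_marketPortfolio_le_one a y) fun n => eq_zero_of_marketPortfolio_eq_zero hS hq
  calc ∫⁻ x, ENNReal.ofReal (-Real.log (wealthShare S (wealthStep ρ x a y))) ∂κ
      ≤ ENNReal.ofReal (∫ x, (-Real.log (wealthShare S y) - H x) ∂κ) := by
        refine lintegral_ofReal_le_ofReal_integral ((integrable_const _).sub hH)
          (fun x => neg_log_wealthShare_nonneg _ _) ?_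
        filter_upwards [ae_growthMinorant_le_log_wealthShare_wealthStep hS hq hκ] with x hx
        linarith [hx.2]
    _ ≤ ENNReal.ofReal (-Real.log (wealthShare S y)) := by
        rw [integral_sub (integrable_const _) hH, integral_const, probReal_univ, one_smul]
        exact ENNReal.ofReal_le_ofReal (sub_le_self _ hH0)

theorem lintegral_wealthShare_wealthStep_lt {m : Fin M}
    (ha : ∀ k ≠ m, (a k).1 = optimalShare κ ρ (∑ k, y k))
    (ham : (a m).1 ≠ optimalShare κ ρ (∑ k, y k)) (hpos : 0 < wealthShare {m} y)
    (hone : wealthShare {m} y ≠ 1) (hκ : ∀ᵐ x ∂κ, 0 < ρ + l1 x) :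
    ∫⁻ x, ENNReal.ofReal (wealthShare {m} (wealthStep ρ x a y)) ∂κ <
      ENNReal.ofReal (wealthShare {m} y) := by
  -- the growth bound is applied to the coalition of all the other investors, with share `q`
  have hy := sum_univ_pos_of_wealthShare_pos hpos
  have hym : 0 < y m := by simpa using sum_pos_of_wealthShare_pos hpos
  have hS : ∀ k ∈ ({m}ᶜ : Finset (Fin M)), (a k).1 = optimalShare κ ρ (∑ k, y k) :=
    fun k hk => ha k (by simpa using hk)
  set q := wealthShare {m}ᶜ y
  have hq_eq : q = 1 - wealthShare {m} y := wealthShare_compl hy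
  have hq : 0 < q := hq_eq ▸ sub_pos.mpr ((wealthShare_le_one _ _).lt_of_ne hone)
  set H := growthMinorant κ ρ (∑ k, y k) (marketPortfolio a y)
  have hH : Integrable H κ := integrable_growthMinorant ..
  have hHpos : 0 < ∫ x, H x ∂κ :=
    integral_growthMinorant_pos hy hκ (sum_marketPortfolio_le_one a y)
      (fun n => eq_zero_of_marketPortfolio_eq_zero hS hq)
      fun h => ham (eq_of_marketPortfolio_eq hym ha h)
  calc ∫⁻ x, ENNReal.ofReal (wealthShare {m} (wealthStep ρ x a y)) ∂κ
      ≤ ENNReal.ofReal (∫ x, (1 - q - q * H x) ∂κ) := by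
        refine lintegral_ofReal_le_ofReal_integral ((integrable_const _).sub (hH.const_mul q))
          (fun x => wealthShare_nonneg _ _) ?_
        filter_upwards [ae_growthMinorant_le_log_wealthShare_wealthStep hS hq hκ] with x ⟨hx, hlog⟩
        have hcompl : wealthShare {m}ᶜ (wealthStep ρ x a y) = 1 - wealthShare {m} _ :=
          wealthShare_compl (sum_univ_pos_of_wealthShare_pos hx)
        have hratio := Real.log_le_sub_one_of_pos (div_pos hx hq)
        rw [Real.log_div hx.ne' hq.ne'] at hratio
        have hgain := (le_div_iff₀' hq).mp
          (show H x + 1 ≤ wealthShare {m}ᶜ (wealthStep ρ x a y) / q by linarith)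
        linarith
    _ = ENNReal.ofReal (wealthShare {m} y - q * ∫ x, H x ∂κ) := by
        rw [integral_sub (integrable_const _) (hH.const_mul q), integral_const, probReal_univ,
          one_smul, integral_const_mul, hq_eq, sub_sub_cancel]
    _ < ENNReal.ofReal (wealthShare {m} y) :=
        (ENNReal.ofReal_lt_ofReal_iff hpos).mpr (sub_lt_self _ (mul_pos hq hHpos))

end Coalition

section Disintegration

variable {Ω E : Type*} {mF m0 : MeasurableSpace Ω} [MeasurableSpace E] {X : Ω → E}

theorem measurable_id_prodMk (hm : mF ≤ m0) (hX : Measurable X) :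
    Measurable[m0, mF.prod inferInstance] fun ω => (ω, X ω) :=
  @Measurable.prodMk _ m0 _ _ mF _ _ _ (measurable_id'' hm) hX

variable {μ : Measure Ω} [IsFiniteMeasure μ] {K : @Kernel Ω E mF _} [IsFiniteKernel K]

theorem measure_inter_preimage_eq_setLIntegral (hm : mF ≤ m0) (hX : Measurable X)
    {A : Set E} (hA : MeasurableSet A)
    (hK : (fun ω => (K ω).real A) =ᵐ[μ] μ⟦X ⁻¹' A | mF⟧)
    {s : Set Ω} (hs : MeasurableSet[mF] s) :
    μ (s ∩ X ⁻¹' A) = ∫⁻ ω in s, K ω A ∂μ := by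
  have hreal : ∫ ω in s, (K ω).real A ∂μ = μ.real (s ∩ X ⁻¹' A) := by
    rw [setIntegral_congr_ae (hm _ hs) (hK.mono fun _ h _ => h),
      setIntegral_condExp hm ((integrable_const _).indicator (hX hA)) hs,
      setIntegral_indicator (hX hA), setIntegral_const, smul_eq_mul, mul_one]
  have hint : Integrable (fun ω => (K ω).real A) (μ.restrict s) :=
    (integrable_condExp.congr hK.symm).integrableOn
  rw [← ofReal_measureReal, ← hreal, ofReal_integral_eq_lintegral_ofReal hint
    (Filter.Eventually.of_forall fun _ => measureReal_nonneg)]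
  exact lintegral_congr fun ω => ofReal_measureReal

theorem map_prodMk_eq_trim_compProd (hm : mF ≤ m0) (hX : Measurable X)
    (hK : ∀ A, MeasurableSet A → (fun ω => (K ω).real A) =ᵐ[μ] μ⟦X ⁻¹' A | mF⟧) :
    @Measure.map Ω (Ω × E) m0 (mF.prod inferInstance) (fun ω => (ω, X ω)) μ =
      @Measure.compProd Ω E mF _ (μ.trim hm) K := by
  let _ : MeasurableSpace (Ω × E) := mF.prod inferInstance
  have : IsFiniteMeasure (μ.map fun ω => (ω, X ω)) := μ.isFiniteMeasure_map _
  refine (@Measure.ext_prod_iff Ω E mF _ _ _ _).mpr fun {s A} hs hA => ?_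
  rw [Measure.map_apply (measurable_id_prodMk hm hX) (hs.prod hA),
    Measure.compProd_apply_prod hs hA, setLIntegral_trim hm (K.measurable_coe hA) hs,
    ← measure_inter_preimage_eq_setLIntegral hm hX hA (hK A hA) hs]
  rfl

theorem setLIntegral_prodMk_eq_lintegral_kernel (hm : mF ≤ m0) (hX : Measurable X)
    (hK : ∀ A, MeasurableSet A → (fun ω => (K ω).real A) =ᵐ[μ] μ⟦X ⁻¹' A | mF⟧)
    {Φ : Ω × E → ℝ≥0∞} (hΦ : Measurable[mF.prod inferInstance] Φ)
    {s : Set Ω} (hs : MeasurableSet[mF] s) :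
    ∫⁻ ω in s, Φ (ω, X ω) ∂μ = ∫⁻ ω in s, ∫⁻ x, Φ (ω, x) ∂(K ω) ∂μ := by
  let _ : MeasurableSpace (Ω × E) := mF.prod inferInstance
  have hin : Measurable[mF] fun ω => ∫⁻ x, Φ (ω, x) ∂(K ω) :=
    @Measurable.lintegral_kernel_prod_right' Ω E mF _ K _ _ hΦ
  have h := @Measure.setLIntegral_compProd _ _ mF _ (μ.trim hm) K _ _ _ hΦ _ hs _
    MeasurableSet.univ
  rw [← map_prodMk_eq_trim_compProd hm hX hK, setLIntegral_map ?_ hΦ (measurable_id_prodMk hm hX),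
    setLIntegral_trim hm ?_ hs, Set.prod_univ] at h
  · change ∫⁻ ω in s, Φ (ω, X ω) ∂μ = _ at h
    simpa only [Measure.restrict_univ] using h
  · simpa only [Measure.restrict_univ] using hin
  · exact hs.prod MeasurableSet.univ

theorem ae_prodMk_iff_ae_ae_kernel (hm : mF ≤ m0) (hX : Measurable X)
    (hK : ∀ A, MeasurableSet A → (fun ω => (K ω).real A) =ᵐ[μ] μ⟦X ⁻¹' A | mF⟧)
    {p : Ω × E → Prop} (hp : MeasurableSet[mF.prod inferInstance] {z | p z}) :
    (∀ᵐ ω ∂μ, p (ω, X ω)) ↔ ∀ᵐ ω ∂μ, ∀ᵐ x ∂(K ω), p (ω, x) := by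
  let _ : MeasurableSpace (Ω × E) := mF.prod inferInstance
  have hsec : MeasurableSet[mF] {ω | ¬ ∀ᵐ x ∂(K ω), p (ω, x)} :=
    (@Kernel.measurable_kernel_prodMk_left Ω E mF _ K _ _ hp.compl _
      (measurableSet_singleton 0)).compl
  rw [← ae_map_iff (measurable_id_prodMk hm hX).aemeasurable hp,
    map_prodMk_eq_trim_compProd hm hX hK, Measure.ae_compProd_iff hp, ae_iff,
    trim_measurableSet_eq hm hsec]
  rfl

theorem ofReal_condExp_ae_eq_lintegral_kernel (hm : mF ≤ m0) (hX : Measurable X)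
    (hK : ∀ A, MeasurableSet A → (fun ω => (K ω).real A) =ᵐ[μ] μ⟦X ⁻¹' A | mF⟧)
    {Φ : Ω × E → ℝ} (hΦ : Measurable[mF.prod inferInstance] Φ) (hΦ0 : ∀ z, 0 ≤ Φ z)
    (hint : Integrable (fun ω => Φ (ω, X ω)) μ) :
    (fun ω => ENNReal.ofReal (μ[fun ω => Φ (ω, X ω) | mF] ω)) =ᵐ[μ]
      fun ω => ∫⁻ x, ENNReal.ofReal (Φ (ω, x)) ∂(K ω) := by
  have hΦ' : Measurable[mF.prod inferInstance] fun z => ENNReal.ofReal (Φ z) := hΦ.ennreal_ofReal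
  have hcond : Measurable[mF] fun ω => ENNReal.ofReal (μ[fun ω => Φ (ω, X ω) | mF] ω) :=
    stronglyMeasurable_condExp.measurable.ennreal_ofReal
  have hker : Measurable[mF] fun ω => ∫⁻ x, ENNReal.ofReal (Φ (ω, x)) ∂(K ω) :=
    @Measurable.lintegral_kernel_prod_right' Ω E mF _ K _ _ hΦ'
  refine ae_eq_of_ae_eq_trim (hm := hm)
    (ae_eq_of_forall_setLIntegral_eq_of_sigmaFinite hcond hker fun s hs _ => ?_)
  rw [setLIntegral_trim hm hcond hs, setLIntegral_trim hm hker hs,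
    ← setLIntegral_prodMk_eq_lintegral_kernel hm hX hK hΦ' hs,
    ← ofReal_integral_eq_lintegral_ofReal integrable_condExp.integrableOn,
    ← ofReal_integral_eq_lintegral_ofReal hint.integrableOn, setIntegral_condExp hm hint hs]
  · exact Filter.Eventually.of_forall fun ω => hΦ0 _
  · exact ae_restrict_of_ae (condExp_nonneg (Filter.Eventually.of_forall fun ω => hΦ0 _))

end Disintegration

section Supermartingale

variable {Ω E : Type*} {m0 : MeasurableSpace Ω} [MeasurableSpace E] {μ : Measure Ω}
  [IsFiniteMeasure μ] {ℱ : Filtration ℕ m0} {X : ℕ → Ω → E}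
  {K : (t : ℕ) → @Kernel Ω E (ℱ t) _} [∀ t, IsFiniteKernel (K t)]
  {f : ℕ → Ω → ℝ} {Φ : ℕ → Ω × E → ℝ}

theorem integrable_of_lintegral_kernel_le (hX : ∀ t, Measurable (X t))
    (hK : ∀ t A, MeasurableSet A → (fun ω => (K t ω).real A) =ᵐ[μ] μ⟦X t ⁻¹' A | ℱ t⟧)
    (hf : ∀ t, Measurable (f t)) (hf0 : ∀ t ω, 0 ≤ f t ω) (hint : Integrable (f 0) μ)
    (hΦ : ∀ t, Measurable[(ℱ t).prod inferInstance] (Φ t))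
    (hfΦ : ∀ t ω, f (t + 1) ω = Φ t (ω, X t ω))
    (hle : ∀ t, ∀ᵐ ω ∂μ, ∫⁻ x, ENNReal.ofReal (Φ t (ω, x)) ∂(K t ω) ≤ ENNReal.ofReal (f t ω))
    (t : ℕ) : Integrable (f t) μ := by
  induction t with
  | zero => exact hint
  | succ t ih =>
    refine (lintegral_ofReal_ne_top_iff_integrable (hf _).aestronglyMeasurable
      (Filter.Eventually.of_forall (hf0 _))).mp (ne_top_of_le_ne_top ih.lintegral_lt_top.ne ?_)
    simp only [hfΦ]
    rw [← setLIntegral_univ, setLIntegral_prodMk_eq_lintegral_kernel (ℱ.le t) (hX t) (hK t)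
      (hΦ t).ennreal_ofReal MeasurableSet.univ, setLIntegral_univ]
    exact lintegral_mono_ae (hle t)

theorem supermartingale_of_lintegral_kernel_le (hX : ∀ t, Measurable (X t))
    (hK : ∀ t A, MeasurableSet A → (fun ω => (K t ω).real A) =ᵐ[μ] μ⟦X t ⁻¹' A | ℱ t⟧)
    (hf : ∀ t, Measurable[ℱ t] (f t)) (hf0 : ∀ t ω, 0 ≤ f t ω) (hint : Integrable (f 0) μ)
    (hΦ : ∀ t, Measurable[(ℱ t).prod inferInstance] (Φ t)) (hΦ0 : ∀ t z, 0 ≤ Φ t z)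
    (hfΦ : ∀ t ω, f (t + 1) ω = Φ t (ω, X t ω))
    (hle : ∀ t, ∀ᵐ ω ∂μ, ∫⁻ x, ENNReal.ofReal (Φ t (ω, x)) ∂(K t ω) ≤ ENNReal.ofReal (f t ω)) :
    Supermartingale f ℱ μ := by
  have hintegrable := integrable_of_lintegral_kernel_le hX hK
    (fun t => (hf t).mono (ℱ.le t) le_rfl) hf0 hint hΦ hfΦ hle
  refine supermartingale_nat (fun t => (hf t).stronglyMeasurable) hintegrable fun t => ?_
  have hsucc : f (t + 1) = fun ω => Φ t (ω, X t ω) := funext (hfΦ t)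
  filter_upwards [hle t, ofReal_condExp_ae_eq_lintegral_kernel (ℱ.le t) (hX t) (hK t) (hΦ t)
    (hΦ0 t) (hsucc ▸ hintegrable (t + 1))] with ω hω hcond
  rw [hsucc, ← ENNReal.ofReal_le_ofReal_iff (hf0 t ω), hcond]
  exact hω

end Supermartingale

section Measurability

variable {α : Type*} [MeasurableSpace α]

theorem measurable_wealthShare {ι : Type*} [Fintype ι] (S : Finset ι) {y : α → ι → ℝ≥0}
    (hy : Measurable y) : Measurable fun p => wealthShare S (y p) := by
  unfold wealthShare
  fun_prop

variable {M N : ℕ}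

theorem measurable_wealthStep {ρ : α → ℝ≥0} {x : α → Fin N → ℝ≥0} {a : α → Fin M → Action N}
    {y : α → Fin M → ℝ≥0} (hρ : Measurable ρ) (hx : Measurable x) (ha : Measurable a)
    (hy : Measurable y) : Measurable fun p => wealthStep (ρ p) (x p) (a p) (y p) := by
  have hcoord (k : Fin M) (n : Fin N) : Measurable fun p => (a p k).1 n :=
    (measurable_pi_apply n).comp (measurable_subtype_coe.comp ((measurable_pi_apply k).comp ha))
  refine measurable_pi_lambda _ fun m => ?_
  unfold wealthStep
  fun_prop

theorem measurable_wealthOf {Ω : Type*} {X : ℕ → Ω → Fin N → ℝ≥0} {ρ : ℕ → Ω → ℝ≥0} {f : α → Ω}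
    {y : α → Fin M → ℝ≥0} (hy : Measurable y) :
    ∀ (t : ℕ) {h : α → Actions M N t}, Measurable h →
      (∀ s < t, Measurable fun p => X (s + 1) (f p)) →
      (∀ s < t, Measurable fun p => ρ (s + 1) (f p)) →
      Measurable fun p => wealthOf X ρ (f p) (y p) t (h p)
  | 0, _, _, _, _ => hy
  | t + 1, h, hh, hX, hρ => by
    have hinit : Measurable fun p => (Fin.init (h p) : Actions M N t) :=
      measurable_pi_lambda _ fun i => (measurable_pi_apply i.castSucc).comp hh
    have ih := measurable_wealthOf hy t hinit (fun s hs => hX s (hs.trans t.lt_succ_self))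
      (fun s hs => hρ s (hs.trans t.lt_succ_self))
    exact measurable_wealthStep (hρ t t.lt_succ_self) (hX t t.lt_succ_self)
      ((measurable_pi_apply (Fin.last t)).comp hh) ih

end Measurability

section History

variable {Ω : Type*} {M N : ℕ} {L L' : Fin M → Rule Ω M N} {y₀ : Fin M → ℝ≥0}

theorem history_eq_of_forall_lt {ω : Ω} :
    ∀ {t : ℕ}, (∀ s < t, ∀ k, L k s = L' k s) → history L y₀ ω t = history L' y₀ ω t
  | 0, _ => rfl
  | t + 1, h => by
    have ih : history L y₀ ω t = history L' y₀ ω t :=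
      history_eq_of_forall_lt fun s hs => h s (hs.trans t.lt_succ_self)
    simp only [history, ih, h t t.lt_succ_self]

variable {m0 : MeasurableSpace Ω} {ℱ : Filtration ℕ m0}

theorem IsStrategy.update {Λ : Rule Ω M N} {m : Fin M} (hΛ : IsStrategy ℱ Λ)
    (hL : ∀ k, k ≠ m → IsStrategy ℱ (L k)) (k : Fin M) :
    IsStrategy ℱ (Function.update L m Λ k) := by
  by_cases hk : k = m
  · simpa [hk] using hΛ
  · simpa [hk] using hL k hk

theorem IsStrategy.update_apply {Λ Λ' : Rule Ω M N} (hΛ : IsStrategy ℱ Λ) (hΛ' : IsStrategy ℱ Λ')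
    (t : ℕ) : IsStrategy ℱ (Function.update Λ t (Λ' t)) := by
  intro s
  rcases eq_or_ne s t with rfl | hs
  · simpa using hΛ' s
  · simpa [hs] using hΛ s

theorem IsStrategy.measurable_apply {Λ : Rule Ω M N} (hΛ : IsStrategy ℱ Λ) {t : ℕ}
    {h : Ω → Actions M N t} (hh : Measurable[ℱ t] h) : Measurable[ℱ t] fun ω => Λ t ω y₀ (h ω) :=
  (hΛ t).comp (@Measurable.prodMk _ (ℱ t) _ _ (ℱ t) _ _ _ measurable_id
    (measurable_const.prodMk hh))

theorem measurable_history (hL : ∀ k, IsStrategy ℱ (L k)) :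
    ∀ t, Measurable[ℱ t] fun ω => history L y₀ ω t
  | 0 => (@measurable_pi_iff _ _ _ (ℱ 0) _ _).mpr fun i => i.elim0
  | t + 1 => by
    have ih := measurable_history hL t
    refine Measurable.mono ?_ (ℱ.mono t.le_succ) le_rfl
    refine (@measurable_pi_iff _ _ _ (ℱ t) _ _).mpr fun i => ?_
    cases i using Fin.lastCases with
    | last =>
      simp only [history, Fin.snoc_last]
      exact (@measurable_pi_iff _ _ _ (ℱ t) _ _).mpr fun k => (hL k).measurable_apply ih
    | cast i =>
      simp only [history, Fin.snoc_castSucc]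
      exact (measurable_pi_apply i).comp ih

theorem measurable_realization (hL : ∀ k, IsStrategy ℱ (L k)) (t : ℕ) :
    Measurable[ℱ t] fun ω k => realization L y₀ k t ω :=
  (@measurable_pi_iff _ _ _ (ℱ t) _ _).mpr fun k =>
    (hL k).measurable_apply (measurable_history hL t)

end History

section Wealth

variable {Ω : Type*} {M N : ℕ} (X : ℕ → Ω → Fin N → ℝ≥0) (ρ : ℕ → Ω → ℝ≥0)
  (L : Fin M → Rule Ω M N) (y₀ : Fin M → ℝ≥0)

theorem wealth_succ (t : ℕ) (ω : Ω) : (fun k => wealth X ρ L y₀ k (t + 1) ω) =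
    wealthStep (ρ (t + 1) ω) (X (t + 1) ω) (fun k => realization L y₀ k t ω)
      fun k => wealth X ρ L y₀ k t ω := by
  simp only [wealth, history, wealthOf, Fin.snoc_last, Fin.init_snoc]
  rfl

theorem relWealth_eq_wealthShare (m : Fin M) (t : ℕ) (ω : Ω) :
    relWealth X ρ L y₀ m t ω = wealthShare {m} fun k => wealth X ρ L y₀ k t ω := by
  rw [relWealth, wealthShare, Finset.sum_singleton]

/-- The share of investor `m` in the total wealth at time `t + 1` as a function of `ω`, observed
at time `t`, and of the payoffs of the next period, given as a separate argument. -/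
noncomputable def nextShare (m : Fin M) (t : ℕ) (p : Ω × (Fin N → ℝ≥0)) : ℝ :=
  wealthShare {m} (wealthStep (ρ (t + 1) p.1) p.2 (fun k => realization L y₀ k t p.1)
    fun k => wealth X ρ L y₀ k t p.1)

theorem relWealth_succ (m : Fin M) (t : ℕ) (ω : Ω) :
    relWealth X ρ L y₀ m (t + 1) ω = nextShare X ρ L y₀ m t (ω, X (t + 1) ω) := by
  rw [relWealth_eq_wealthShare, wealth_succ, nextShare]

theorem relWealth_zero_pos {y₀ : Fin M → ℝ≥0} (hy : ∀ k, 0 < y₀ k) (m : Fin M) (ω : Ω) :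
    0 < relWealth X ρ L y₀ m 0 ω :=
  div_pos (by exact_mod_cast hy m)
    (Finset.sum_pos (fun k _ => by exact_mod_cast hy k) ⟨m, Finset.mem_univ m⟩)

variable {X ρ L y₀} in
theorem relWealth_congr {L' : Fin M → Rule Ω M N} {t : ℕ} {ω : Ω}
    (h : history L y₀ ω t = history L' y₀ ω t) (m : Fin M) :
    relWealth X ρ L y₀ m t ω = relWealth X ρ L' y₀ m t ω := by
  simp only [relWealth, wealth, h]

theorem realization_eq_optimalShare {m0 : MeasurableSpace Ω} {ℱ : Filtration ℕ m0}
    {K : (t : ℕ) → @Kernel Ω (Fin N → ℝ≥0) (ℱ t) _} [∀ t, IsMarkovKernel (K t)]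
    {L : Fin M → Rule Ω M N} {k : Fin M} {t : ℕ} (h : L k t = optimalRule X ρ ℱ K t) (ω : Ω) :
    (realization L y₀ k t ω).1 =
      optimalShare (K t ω) (ρ (t + 1) ω) (∑ j, wealth X ρ L y₀ j t ω) := by
  rw [realization, h]
  rfl

end Wealth

section Market

variable {Ω : Type*} {m0 : MeasurableSpace Ω} {M N : ℕ}

/-- The standing measurability assumptions on the payoffs and on the returns of the bank account:
`X_{t+1}` is known at time `t + 1`, but `ρ_{t+1}` already at time `t`. -/
structure IsAdaptedMarket (X : ℕ → Ω → Fin N → ℝ≥0) (ρ : ℕ → Ω → ℝ≥0) (ℱ : Filtration ℕ m0) :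
    Prop where
  measurable_payoff : ∀ t, Measurable[ℱ (t + 1)] (X (t + 1))
  measurable_return : ∀ t, Measurable[ℱ t] (ρ (t + 1))

/-- All standing assumptions on the market, `K t` being the conditional distribution of `X_{t+1}`
given `ℱ t`. -/
structure IsMarket (X : ℕ → Ω → Fin N → ℝ≥0) (ρ : ℕ → Ω → ℝ≥0) (μ : Measure Ω)
    (ℱ : Filtration ℕ m0) (K : (t : ℕ) → @Kernel Ω (Fin N → ℝ≥0) (ℱ t) _) : Prop
    extends IsAdaptedMarket X ρ ℱ where
  return_add_payoff_pos : ∀ t, ∀ᵐ ω ∂μ, 0 < ρ (t + 1) ω + ∑ n, X (t + 1) ω n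
  condDistrib : IsRegularCondDistrib X μ ℱ K

variable {ℱ : Filtration ℕ m0} {X : ℕ → Ω → Fin N → ℝ≥0} {ρ : ℕ → Ω → ℝ≥0}

theorem IsAdaptedMarket.isStrategy_optimalRule (h : IsAdaptedMarket X ρ ℱ)
    (K : (t : ℕ) → @Kernel Ω (Fin N → ℝ≥0) (ℱ t) _) [∀ t, IsMarkovKernel (K t)] :
    IsStrategy ℱ (optimalRule X ρ ℱ K : Rule Ω M N) := by
  intro t
  let _ : MeasurableSpace (Ω × ((Fin M → ℝ≥0) × Actions M N t)) := (ℱ t).prod inferInstance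
  have hfst : Measurable[_, ℱ t] (Prod.fst : Ω × ((Fin M → ℝ≥0) × Actions M N t) → Ω) :=
    @measurable_fst _ _ (ℱ t) _
  have hsnd : Measurable (Prod.snd : Ω × ((Fin M → ℝ≥0) × Actions M N t) → _) :=
    @measurable_snd _ _ (ℱ t) _
  have hW : Measurable fun p : Ω × ((Fin M → ℝ≥0) × Actions M N t) =>
      totalWealthOf X ρ p.1 p.2.1 t p.2.2 := by
    refine Finset.measurable_fun_sum _ fun m _ => (measurable_pi_apply m).comp ?_
    refine measurable_wealthOf (measurable_fst.comp hsnd) t (measurable_snd.comp hsnd) ?_ ?_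
    · exact fun s hs => ((h.measurable_payoff s).mono (ℱ.mono hs) le_rfl).comp hfst
    · exact fun s hs => ((h.measurable_return s).mono (ℱ.mono hs.le) le_rfl).comp hfst
  refine Measurable.subtype_mk (measurable_pi_lambda _ fun n => ?_)
  exact measurable_optimalShare (Kernel.comap (K t) Prod.fst hfst)
    ((h.measurable_return t).comp hfst) hW n

variable {L : Fin M → Rule Ω M N} {y₀ : Fin M → ℝ≥0}

theorem IsAdaptedMarket.measurable_wealth (h : IsAdaptedMarket X ρ ℱ)
    (hL : ∀ k, IsStrategy ℱ (L k)) (t : ℕ) : Measurable[ℱ t] fun ω k => wealth X ρ L y₀ k t ω :=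
  @measurable_wealthOf Ω (ℱ t) M N Ω X ρ id _ measurable_const t _ (measurable_history hL t)
    (fun s hs => (h.measurable_payoff s).mono (ℱ.mono hs) le_rfl)
    (fun s hs => (h.measurable_return s).mono (ℱ.mono hs.le) le_rfl)

theorem IsAdaptedMarket.measurable_relWealth (h : IsAdaptedMarket X ρ ℱ)
    (hL : ∀ k, IsStrategy ℱ (L k)) (m : Fin M) (t : ℕ) :
    Measurable[ℱ t] (relWealth X ρ L y₀ m t) := by
  simp only [funext (relWealth_eq_wealthShare X ρ L y₀ m t)]
  exact @measurable_wealthShare _ (ℱ t) _ _ {m} _ (h.measurable_wealth hL t)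

theorem IsAdaptedMarket.measurable_nextShare (h : IsAdaptedMarket X ρ ℱ)
    (hL : ∀ k, IsStrategy ℱ (L k)) (m : Fin M) (t : ℕ) :
    Measurable[(ℱ t).prod inferInstance] (nextShare X ρ L y₀ m t) := by
  let _ : MeasurableSpace (Ω × (Fin N → ℝ≥0)) := (ℱ t).prod inferInstance
  have hfst : Measurable[_, ℱ t] (Prod.fst : Ω × (Fin N → ℝ≥0) → Ω) := @measurable_fst _ _ (ℱ t) _
  exact measurable_wealthShare _ (measurable_wealthStep ((h.measurable_return t).comp hfst)
    (@measurable_snd _ _ (ℱ t) _) ((measurable_realization hL t).comp hfst)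
    ((h.measurable_wealth hL t).comp hfst))

variable {μ : Measure Ω} {K : (t : ℕ) → @Kernel Ω (Fin N → ℝ≥0) (ℱ t) _}

theorem IsMarket.measurable_payoff_succ (h : IsMarket X ρ μ ℱ K) (t : ℕ) : Measurable (X (t + 1)) :=
  (h.measurable_payoff t).mono (ℱ.le _) le_rfl

theorem IsMarket.ae_ae_kernel_pos [IsFiniteMeasure μ] (h : IsMarket X ρ μ ℱ K) (t : ℕ)
    [IsFiniteKernel (K t)] : ∀ᵐ ω ∂μ, ∀ᵐ x ∂(K t ω), 0 < ρ (t + 1) ω + l1 x := by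
  have hmeas : Measurable[(ℱ t).prod inferInstance]
      fun p : Ω × (Fin N → ℝ≥0) => ρ (t + 1) p.1 + l1 p.2 :=
    ((h.measurable_return t).comp (@measurable_fst _ _ (ℱ t) _)).add
      (measurable_l1.comp (@measurable_snd _ _ (ℱ t) _))
  exact (ae_prodMk_iff_ae_ae_kernel (ℱ.le t) (h.measurable_payoff_succ t) (h.condDistrib t)
    (hmeas measurableSet_Ioi)).mp (h.return_add_payoff_pos t)

end Market

section NextShare

variable {Ω : Type*} {m0 : MeasurableSpace Ω} {ℱ : Filtration ℕ m0} {M N : ℕ}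
  {X : ℕ → Ω → Fin N → ℝ≥0} {ρ : ℕ → Ω → ℝ≥0}
  {K : (t : ℕ) → @Kernel Ω (Fin N → ℝ≥0) (ℱ t) _} [∀ t, IsMarkovKernel (K t)]
  {L : Fin M → Rule Ω M N} {y₀ : Fin M → ℝ≥0} {m : Fin M} {t : ℕ} {ω : Ω}

theorem ae_nextShare_pos (hm : L m t = optimalRule X ρ ℱ K t)
    (hpos : 0 < relWealth X ρ L y₀ m t ω) (hκ : ∀ᵐ x ∂(K t ω), 0 < ρ (t + 1) ω + l1 x) :
    ∀ᵐ x ∂(K t ω), 0 < nextShare X ρ L y₀ m t (ω, x) := by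
  rw [relWealth_eq_wealthShare] at hpos
  have hopt : ∀ k ∈ ({m} : Finset (Fin M)), (realization L y₀ k t ω).1 =
      optimalShare (K t ω) (ρ (t + 1) ω) (∑ j, wealth X ρ L y₀ j t ω) := fun k hk =>
    realization_eq_optimalShare X ρ y₀ (Finset.mem_singleton.mp hk ▸ hm) ω
  exact (ae_growthMinorant_le_log_wealthShare_wealthStep
    (a := fun k => realization L y₀ k t ω) hopt hpos hκ).mono fun x hx => hx.1

theorem lintegral_neg_log_nextShare_le (hm : L m t = optimalRule X ρ ℱ K t)
    (hpos : 0 < relWealth X ρ L y₀ m t ω) (hκ : ∀ᵐ x ∂(K t ω), 0 < ρ (t + 1) ω + l1 x) :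
    ∫⁻ x, ENNReal.ofReal (-Real.log (nextShare X ρ L y₀ m t (ω, x))) ∂(K t ω) ≤
      ENNReal.ofReal (-Real.log (relWealth X ρ L y₀ m t ω)) := by
  rw [relWealth_eq_wealthShare] at hpos ⊢
  have hopt : ∀ k ∈ ({m} : Finset (Fin M)), (realization L y₀ k t ω).1 =
      optimalShare (K t ω) (ρ (t + 1) ω) (∑ j, wealth X ρ L y₀ j t ω) := fun k hk =>
    realization_eq_optimalShare X ρ y₀ (Finset.mem_singleton.mp hk ▸ hm) ω
  simp only [nextShare]
  exact lintegral_neg_log_wealthShare_wealthStep_le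
    (a := fun k => realization L y₀ k t ω) hopt hpos hκ

theorem lintegral_nextShare_lt (hopt : ∀ k ≠ m, L k t = optimalRule X ρ ℱ K t)
    (hne : (realization L y₀ m t ω).1 ≠
      optimalShare (K t ω) (ρ (t + 1) ω) (∑ j, wealth X ρ L y₀ j t ω))
    (hpos : 0 < relWealth X ρ L y₀ m t ω) (hone : relWealth X ρ L y₀ m t ω ≠ 1)
    (hκ : ∀ᵐ x ∂(K t ω), 0 < ρ (t + 1) ω + l1 x) :
    ∫⁻ x, ENNReal.ofReal (nextShare X ρ L y₀ m t (ω, x)) ∂(K t ω) <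
      ENNReal.ofReal (relWealth X ρ L y₀ m t ω) := by
  rw [relWealth_eq_wealthShare] at hpos hone ⊢
  have hopt' : ∀ k ≠ m, (realization L y₀ k t ω).1 =
      optimalShare (K t ω) (ρ (t + 1) ω) (∑ j, wealth X ρ L y₀ j t ω) := fun k hk =>
    realization_eq_optimalShare X ρ y₀ (hopt k hk) ω
  simp only [nextShare]
  exact lintegral_wealthShare_wealthStep_lt
    (a := fun k => realization L y₀ k t ω) hopt' hne hpos hone hκ

end NextShare

section Optimality

variable {Ω : Type*} {m0 : MeasurableSpace Ω} {μ : Measure Ω} [IsFiniteMeasure μ]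
  {ℱ : Filtration ℕ m0} {M N : ℕ} {X : ℕ → Ω → Fin N → ℝ≥0} {ρ : ℕ → Ω → ℝ≥0}
  {K : (t : ℕ) → @Kernel Ω (Fin N → ℝ≥0) (ℱ t) _} [∀ t, IsMarkovKernel (K t)]
  {L : Fin M → Rule Ω M N} {y₀ : Fin M → ℝ≥0} {m : Fin M}

namespace IsMarket

theorem ae_relWealth_pos (h : IsMarket X ρ μ ℱ K) (hL : ∀ k, IsStrategy ℱ (L k))
    (hm : L m = optimalRule X ρ ℱ K) (hy : ∀ k, 0 < y₀ k) :
    ∀ t, ∀ᵐ ω ∂μ, 0 < relWealth X ρ L y₀ m t ω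
  | 0 => .of_forall (relWealth_zero_pos X ρ L hy m)
  | t + 1 => by
    simp only [relWealth_succ]
    refine (ae_prodMk_iff_ae_ae_kernel (ℱ.le t) (h.measurable_payoff_succ t) (h.condDistrib t)
      (h.measurable_nextShare hL m t measurableSet_Ioi)).mpr ?_
    filter_upwards [ae_relWealth_pos h hL hm hy t, h.ae_ae_kernel_pos t] with ω hpos hκ
    exact ae_nextShare_pos (congrFun hm t) hpos hκ

theorem supermartingale_neg_log_relWealth (h : IsMarket X ρ μ ℱ K)
    (hL : ∀ k, IsStrategy ℱ (L k)) (hm : L m = optimalRule X ρ ℱ K) (hy : ∀ k, 0 < y₀ k) :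
    Supermartingale (fun t ω => -Real.log (relWealth X ρ L y₀ m t ω)) ℱ μ := by
  have hfinite (t : ℕ) : IsFiniteKernel (K t) := inferInstance
  have hint : Integrable (fun ω => -Real.log (relWealth X ρ L y₀ m 0 ω)) μ :=
    integrable_const (-Real.log ((y₀ m : ℝ) / ∑ k, (y₀ k : ℝ)))
  refine supermartingale_of_lintegral_kernel_le h.measurable_payoff_succ h.condDistrib
    (Φ := fun t p => -Real.log (nextShare X ρ L y₀ m t p))
    (fun t => (h.measurable_relWealth hL m t).log.neg) (fun t ω => ?_) hint
    (fun t => (h.measurable_nextShare hL m t).log.neg)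
    (fun t p => neg_log_wealthShare_nonneg _ _) (fun t ω => by rw [relWealth_succ]) fun t => ?_
  · rw [relWealth_eq_wealthShare]
    exact neg_log_wealthShare_nonneg _ _
  · filter_upwards [h.ae_relWealth_pos hL hm hy t, h.ae_ae_kernel_pos t] with ω hpos hκ
    exact lintegral_neg_log_nextShare_le (congrFun hm t) hpos hκ

theorem isRelativeGrowthOptimal_optimalRule (h : IsMarket X ρ μ ℱ K) (m : Fin M) :
    IsRelativeGrowthOptimal X ρ μ ℱ m (optimalRule X ρ ℱ K) := by
  intro y₀ hy L hL
  have hL' := (h.isStrategy_optimalRule K).update hL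
  have hm := Function.update_self m (optimalRule X ρ ℱ K) L
  refine ⟨h.ae_relWealth_pos hL' hm hy, ?_⟩
  simpa only [Pi.neg_def, neg_neg] using (h.supermartingale_neg_log_relWealth hL' hm hy).neg

end IsMarket

end Optimality

section Uniqueness

variable {Ω : Type*} {m0 : MeasurableSpace Ω} {μ : Measure Ω} [IsFiniteMeasure μ]
  {ℱ : Filtration ℕ m0} {M N : ℕ} {X : ℕ → Ω → Fin N → ℝ≥0} {ρ : ℕ → Ω → ℝ≥0}
  {K : (t : ℕ) → @Kernel Ω (Fin N → ℝ≥0) (ℱ t) _} [∀ t, IsMarkovKernel (K t)]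
  {L : Fin M → Rule Ω M N} {y₀ : Fin M → ℝ≥0} {m : Fin M} {Λ : Rule Ω M N}

namespace IsMarket

theorem ofReal_condExp_relWealth_ae_eq (h : IsMarket X ρ μ ℱ K) (hL : ∀ k, IsStrategy ℱ (L k))
    {t : ℕ} (hint : Integrable (relWealth X ρ L y₀ m (t + 1)) μ) :
    (fun ω => ENNReal.ofReal (μ[relWealth X ρ L y₀ m (t + 1) | ℱ t] ω)) =ᵐ[μ]
      fun ω => ∫⁻ x, ENNReal.ofReal (nextShare X ρ L y₀ m t (ω, x)) ∂(K t ω) := by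
  rw [funext (relWealth_succ X ρ L y₀ m t)] at hint ⊢
  exact ofReal_condExp_ae_eq_lintegral_kernel (ℱ.le t) (h.measurable_payoff_succ t)
    (h.condDistrib t) (h.measurable_nextShare hL m t) (fun p => wealthShare_nonneg _ _) hint

theorem ae_realization_eq_optimalShare (h : IsMarket X ρ μ ℱ K) (hL : ∀ k, IsStrategy ℱ (L k))
    {t : ℕ} (hopt : ∀ k ≠ m, L k t = optimalRule X ρ ℱ K t)
    (hsub : Submartingale (relWealth X ρ L y₀ m) ℱ μ) :
    ∀ᵐ ω ∂μ, 0 < relWealth X ρ L y₀ m t ω → relWealth X ρ L y₀ m t ω ≠ 1 →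
      (realization L y₀ m t ω).1 =
        optimalShare (K t ω) (ρ (t + 1) ω) (∑ k, wealth X ρ L y₀ k t ω) := by
  have hnext := h.ofReal_condExp_relWealth_ae_eq hL (hsub.integrable (t + 1))
  filter_upwards [hsub.ae_le_condExp t.le_succ, hnext, h.ae_ae_kernel_pos t]
    with ω hle hcond hκ hpos hone
  by_contra hne
  have hlt := lintegral_nextShare_lt hopt hne hpos hone hκ
  rw [← hcond] at hlt
  exact hlt.not_ge (ENNReal.ofReal_le_ofReal hle)

theorem ae_apply_history_eq_optimalRule (h : IsMarket X ρ μ ℱ K) (hΛ : IsStrategy ℱ Λ)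
    (hsub : RelWealthSubmartingale X ρ μ ℱ m Λ) (hy : ∀ k, 0 < y₀ k)
    (hL : ∀ k, k ≠ m → IsStrategy ℱ (L k)) (t : ℕ) :
    ∀ᵐ ω ∂μ, 0 < relWealth X ρ (Function.update L m Λ) y₀ m t ω →
      relWealth X ρ (Function.update L m Λ) y₀ m t ω ≠ 1 →
      Λ t ω y₀ (history (Function.update L m Λ) y₀ ω t) =
        optimalRule X ρ ℱ K t ω y₀ (history (Function.update L m Λ) y₀ ω t) := by
  -- all the others switch to the optimal rule at time `t`, which does not affect the past
  set L' : Fin M → Rule Ω M N := fun k => Function.update (L k) t (optimalRule X ρ ℱ K t)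
  have hL' : ∀ k, k ≠ m → IsStrategy ℱ (L' k) := fun k hk =>
    (hL k hk).update_apply (h.isStrategy_optimalRule K) t
  have hhist (ω : Ω) : history (Function.update L' m Λ) y₀ ω t =
      history (Function.update L m Λ) y₀ ω t :=
    history_eq_of_forall_lt fun s hs k => by
      rcases eq_or_ne k m with rfl | hk
      · simp
      · simp [L', hk, hs.ne]
  filter_upwards [h.ae_realization_eq_optimalShare (hΛ.update hL') (t := t)
    (fun k hk => by simp [L', hk]) (hsub y₀ hy L' hL')] with ω hω hpos hone
  rw [relWealth_congr (hhist ω)] at hω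
  have hshare := hω hpos hone
  simp only [realization, wealth, hhist, Function.update_self] at hshare
  exact Subtype.ext hshare

theorem ae_history_eq (h : IsMarket X ρ μ ℱ K) (hΛ : IsStrategy ℱ Λ)
    (hsub : RelWealthSubmartingale X ρ μ ℱ m Λ) (hy : ∀ k, 0 < y₀ k)
    (hL : ∀ k, k ≠ m → IsStrategy ℱ (L k)) :
    ∀ t, ∀ᵐ ω ∂μ, (∀ s < t, relWealth X ρ (Function.update L m Λ) y₀ m s ω ≠ 1) →
      history (Function.update L m (optimalRule X ρ ℱ K)) y₀ ω t =
        history (Function.update L m Λ) y₀ ω t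
  | 0 => .of_forall fun _ _ => rfl
  | t + 1 => by
    filter_upwards [ae_history_eq h hΛ hsub hy hL t,
      (h.isRelativeGrowthOptimal_optimalRule m y₀ hy L hL).1 t,
      h.ae_apply_history_eq_optimalRule hΛ hsub hy hL t] with ω ih hpos heq hone
    have hhist := ih fun s hs => hone s (hs.trans t.lt_succ_self)
    have hact := heq (relWealth_congr (X := X) (ρ := ρ) hhist m ▸ hpos) (hone t t.lt_succ_self)
    simp only [history, hhist]
    congr 1
    funext k
    rcases eq_or_ne k m with rfl | hk
    · simpa using hact.symm
    · simp [hk]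

theorem equalInRealizationUntil_hitOne (h : IsMarket X ρ μ ℱ K) (hΛ : IsStrategy ℱ Λ)
    (hsub : RelWealthSubmartingale X ρ μ ℱ m Λ) :
    EqualInRealizationUntil μ ℱ m (optimalRule X ρ ℱ K) Λ (hitOne X ρ m) := by
  intro y₀ hy L hL
  filter_upwards [ae_all_iff.mpr (h.ae_history_eq hΛ hsub hy hL)] with ω hω t ht
  have hne : ∀ s < t + 1, relWealth X ρ (Function.update L m Λ) y₀ m s ω ≠ 1 := fun s hs hone =>
    hs.not_ge (Nat.cast_le.mp (ht.trans ((min_le_right _ _).trans (iInf₂_le s hone))))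
  have hlast := congrFun (congrFun (hω (t + 1) hne) (Fin.last t)) m
  simpa only [history, Fin.snoc_last, realization] using hlast

end IsMarket

end Uniqueness

end AssetMarketGame

theorem theorem1 {Ω : Type*} {m0 : MeasurableSpace Ω} (μ : Measure Ω) [IsProbabilityMeasure μ]
    (ℱ : Filtration ℕ m0) (M N : ℕ) (hM : 2 ≤ M) (hN : 1 ≤ N)
    (X : ℕ → Ω → Fin N → ℝ≥0) (ρ : ℕ → Ω → ℝ≥0)
    (hX : ∀ t : ℕ, Measurable[ℱ (t + 1)] (X (t + 1)))
    (hρ : ∀ t : ℕ, Measurable[ℱ t] (ρ (t + 1)))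
    (hpos : ∀ t : ℕ, ∀ᵐ ω ∂μ, 0 < ρ (t + 1) ω + ∑ n, X (t + 1) ω n)
    (K : (t : ℕ) → @Kernel Ω (Fin N → ℝ≥0) (ℱ t) _) [∀ t, IsMarkovKernel (K t)]
    (hK : IsRegularCondDistrib X μ ℱ K) (m : Fin M) :
    IsStrategy ℱ (optimalRule X ρ ℱ K : Rule Ω M N) ∧
    IsRelativeGrowthOptimal X ρ μ ℱ m (optimalRule X ρ ℱ K) ∧
    ∀ Λ : Rule Ω M N, IsStrategy ℱ Λ → RelWealthSubmartingale X ρ μ ℱ m Λ →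
      EqualInRealizationUntil μ ℱ m (optimalRule X ρ ℱ K) Λ (hitOne X ρ m) := by
  have hmarket : IsMarket X ρ μ ℱ K := ⟨⟨hX, hρ⟩, hpos, hK⟩
  exact ⟨hmarket.isStrategy_optimalRule K, hmarket.isRelativeGrowthOptimal_optimalRule m,
    fun Λ hΛ hsub => hmarket.equalInRealizationUntil_hitOne hΛ hsub⟩
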